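/- For $\beta\ge 0$ let $Q^{(\beta)}=(Q_t^{(\beta)})_{t\ge0}$ be the Feller semigroup on $\mathbb R_+=[0,\infty)$ with generator $x\partial^2+\beta\partial$ on smooth functions with compact support in $[0,\infty)$ (squared Bessel process, scaled by 2), and let $\mathbb Q^{(\beta)}=(\mathbb Q_t^{(\beta)})_{t\ge0}$ be the Feller semigroup on $\mathbb Z_+$ of the linear birth-death process, with generator $f\mapsto (n+\beta)(f(n+1)-f(n))+n(f(n-1)-f(n))$ on finitely supported functions. Both are given by Markov kernels, through which they act on functions by integration. Put $$d_vf(x)=f(vx),\qquad \mathbb D_vf(n)=\sum_{m=0}^n\binom nm v^m(1-v)^{n-m}f(m),\qquad \Lambda g(x)=\mathbb E[g(\mathrm{Pois}(x))],\qquad \Lambda_\sigma=d_\sigma\Lambda ,$$ where $\mathrm{Pois}(x)$ is a Poisson variable of parameter $x$. For $(u,v)\in\mathcal S=\mathbb R_+\times(0,\infty)$ put $S^{(\beta)}_{(u,v)}=Q_u^{(\beta)}d_v$ and $\mathbb S^{(\beta)}_{(u,v)}=\mathbb Q_u^{(\beta)}\mathbb D_v$, and for $\varsigma,t\ge0$ put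 $K_t^{(\beta,\varsigma)}=S^{(\beta)}_{(\varsigma(e^t-1),e^{-t})}$ and $\mathbb K_t^{(\beta,\varsigma)}=\mathbb S^{(\beta)}_{(\varsigma(e^t-1),e^{-t})}$. Let $\nu_{\beta,\varsigma}$ be the gamma distribution of shape $\beta$ and scale $\varsigma$ on $\mathbb R_+$ (the Dirac mass at $0$ if $\beta\varsigma=0$), and let $\mathbf n_{\beta,s}$ be the negative binomial distribution $\mathbf n_{\beta,s}(n)=(1+s)^{-\beta}\big(\tfrac{s}{1+s}\big)^n\frac{\beta(\beta+1)\cdots(\beta+n-1)}{n!}$ on $\mathbb Z_+$. Let $\mathbf c_0(\mathbb Z_+)$ be the space of real functions on $\mathbb Z_+$ vanishing at infinity. All functions are real-valued. **Proposition.** Let $\beta\ge0$. 1. Let $\sigma\ge 0$ and $(u,v)\in\mathcal S$. (a) If $2\sigma u(v-1)<1$, in particular if $v\le 1$, then on $\mathbf c_0(\mathbb Z_+)$ $$S^{(\beta)}_{(u,v)}\Lambda_\sigma=\Lambda_\sigma\,\mathbb S^{(\beta)}_{(\sigma u,v)},$$ all series on the right-hand side being absolutely convergent, and $\mathbb S^{(\beta)}_{(\sigma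 u,v)}=\mathbb Q^{(\beta)}_{\sigma u}\mathbb D_v=\mathbb D_v\mathbb Q^{(\beta)}_{v\sigma u}$ there. (b) Without this restriction on $(u,v)$, the identity $S^{(\beta)}_{(u,v)}\Lambda_\sigma f(x)=\Lambda_\sigma\mathbb S^{(\beta)}_{(\sigma u,v)}f(x)$ holds for all $f\in\mathbf c_0(\mathbb Z_+)$ and $x\ge0$ such that $\mathbb D_vf$ is integrable with respect to the law $\Lambda_\sigma\mathbb Q^{(\beta)}_{\sigma u}(x,\cdot)$. (c) Without this restriction on $(u,v)$, one has $S^{(\beta)}_{(u,v)}\Lambda_\sigma=\Lambda_\sigma\,\mathbb D_v\mathbb Q^{(\beta)}_{v\sigma u}$ on all of $\mathbf c_0(\mathbb Z_+)$, the outer Poisson series of the right-hand side being absolutely convergent. 2. For all $\varsigma,\sigma,t\ge0$, $$K_t^{(\beta,\varsigma)}\Lambda_\sigma=\Lambda_\sigma\,\mathbb K_t^{(\beta,\varsigma\sigma)}\qquad\text{on }\mathbf c_0(\mathbb Z_+).$$ 3. Let $\varsigma,\sigma\ge0$. The kernels $\Lambda_\sigma$, $K_t^{(\beta,\varsigma)}$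 and $\mathbb K_t^{(\beta,\varsigma\sigma)}$ $(t\ge 0)$ define, by almost everywhere absolutely convergent integrals, bounded operators $\ell^2(\mathbf n_{\beta,\varsigma\sigma})\to \mathbf L^2(\nu_{\beta,\varsigma})$, on $\mathbf L^2(\nu_{\beta,\varsigma})$ and on $\ell^2(\mathbf n_{\beta,\varsigma\sigma})$ respectively, and for all $t\ge0$ $$K_t^{(\beta,\varsigma)}\Lambda_\sigma=\Lambda_\sigma\,\mathbb K_t^{(\beta,\varsigma\sigma)}\qquad\text{on }\ell^2(\mathbf n_{\beta,\varsigma\sigma}).$$ If moreover $\sigma>0$ or $\beta\varsigma=0$, there is a unitary operator $U:\mathbf L^2(\nu_{\beta,\varsigma})\to\ell^2(\mathbf n_{\beta,\varsigma\sigma})$, independent of $t$, such that $UK_t^{(\beta,\varsigma)}=\mathbb K_t^{(\beta,\varsigma\sigma)}U$ for all $t\ge0$. -/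

import Mathlib

open MeasureTheory ProbabilityTheory Filter Topology
open scoped NNReal ENNReal ContDiff ZeroAtInfty

noncomputable section

/-! ### Feller semigroups and their generators -/

/-- The action `f ↦ (x ↦ ∫ f(y) κ(x, dy))` of a kernel on real functions. -/
def kernelAct {E F : Type*} [MeasurableSpace E] [MeasurableSpace F]
    (κ : Kernel E F) (f : F → ℝ) : E → ℝ :=
  fun x => ∫ y, f y ∂(κ x)

/-- `κ` is a (conservative) Feller semigroup on `E`: Markov kernels with the semigroup property,
leaving `C₀(E)` invariant and strongly continuous on it. -/
structure IsFellerSemigroup {E : Type*} [TopologicalSpace E] [MeasurableSpace E]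
    (κ : ℝ≥0 → Kernel E E) : Prop where
  markov : ∀ t, IsMarkovKernel (κ t)
  zero : κ 0 = Kernel.id
  add : ∀ s t, κ (s + t) = κ t ∘ₖ κ s
  feller : ∀ (t : ℝ≥0) (f : C₀(E, ℝ)), ∃ g : C₀(E, ℝ), ∀ x, g x = kernelAct (κ t) f x
  strong_continuous : ∀ f : C₀(E, ℝ),
    TendstoUniformly (fun (t : ℝ≥0) x => kernelAct (κ t) f x) f (𝓝 0)

/-- `f` is in the domain of the generator of `κ`, with image `g`: the difference quotients
`(κ_t f - f) / t` converge to `g` in supremum norm as `t ↓ 0`. -/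
def GeneratorMaps {E : Type*} [MeasurableSpace E]
    (κ : ℝ≥0 → Kernel E E) (f g : E → ℝ) : Prop :=
  TendstoUniformly (fun (t : ℝ≥0) x => (kernelAct (κ t) f x - f x) / (t : ℝ)) g (𝓝[>] 0)

/-- `Q` is the semigroup of the (scaled by 2) squared Bessel process of index `β - 1` on `[0, ∞)`:
the Feller semigroup whose generator is `x ∂² + β ∂` on smooth functions with compact support
in `[0, ∞)` (restrictions of elements of `C_c^∞(ℝ)`). -/
structure IsSquaredBesselSemigroup (β : ℝ≥0) (Q : ℝ≥0 → Kernel ℝ≥0 ℝ≥0) : Prop where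
  isFeller : IsFellerSemigroup Q
  generator : ∀ φ : ℝ → ℝ, ContDiff ℝ ∞ φ → HasCompactSupport φ →
    GeneratorMaps Q (fun x : ℝ≥0 => φ x)
      (fun x : ℝ≥0 => (x : ℝ) * deriv (deriv φ) x + (β : ℝ) * deriv φ x)

/-- `P` is the semigroup of the linear birth-death process on `ℤ₊` with birth rates `n + β` and
death rates `n`: the Feller semigroup whose generator is `(n + β) ∂₊ + n ∂₋` on finitely
supported functions. -/
structure IsLinearBirthDeathSemigroup (β : ℝ≥0) (P : ℝ≥0 → Kernel ℕ ℕ) : Prop where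
  isFeller : IsFellerSemigroup P
  generator : ∀ f : ℕ → ℝ, f.support.Finite →
    GeneratorMaps P f
      (fun n => ((n : ℝ) + (β : ℝ)) * (f (n + 1) - f n) + (n : ℝ) * (f (n - 1) - f n))

/-! ### Dilations, the Poisson kernel, the two-parameter operators -/

/-- The dilation `d_v f(x) = f(v x)`. -/
def dil (v : ℝ≥0) (f : ℝ≥0 → ℝ) : ℝ≥0 → ℝ := fun x => f (v * x)

/-- The binomial operator `𝔻_v f(n) = ∑_{m ≤ n} f(m) C(n, m) v^m (1 - v)^{n - m}`. -/
def discDil (v : ℝ≥0) (f : ℕ → ℝ) : ℕ → ℝ := fun n =>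
  ∑ m ∈ Finset.range (n + 1), f m * ((n.choose m : ℝ) * (v : ℝ) ^ m * (1 - (v : ℝ)) ^ (n - m))

/-- `Λ g(x) = E[g(Pois(x))]`. -/
def poissonAct (g : ℕ → ℝ) : ℝ≥0 → ℝ := fun x => ∫ n, g n ∂(poissonMeasure x)

/-- `Λ_σ = d_σ Λ`. -/
def poissonDil (σ : ℝ≥0) (g : ℕ → ℝ) : ℝ≥0 → ℝ := dil σ (poissonAct g)

/-- `S_{(u,v)} = Q_u d_v`. -/
def contS (Q : ℝ≥0 → Kernel ℝ≥0 ℝ≥0) (u v : ℝ≥0) (f : ℝ≥0 → ℝ) : ℝ≥0 → ℝ :=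
  kernelAct (Q u) (dil v f)

/-- `𝕊_{(u,v)} = P_u 𝔻_v`. -/
def discS (P : ℝ≥0 → Kernel ℕ ℕ) (u v : ℝ≥0) (f : ℕ → ℝ) : ℕ → ℝ :=
  kernelAct (P u) (discDil v f)

/-- The number `ς (e^t - 1) ≥ 0`. -/
def lagU (ς t : ℝ≥0) : ℝ≥0 := Real.toNNReal ((ς : ℝ) * (Real.exp (t : ℝ) - 1))

/-- The number `e^{-t} > 0`. -/
def lagV (t : ℝ≥0) : ℝ≥0 := Real.toNNReal (Real.exp (-(t : ℝ)))

/-- The Laguerre operators `K_t^{(ς)} = S_{(ς(e^t - 1), e^{-t})}`. -/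
def contK (Q : ℝ≥0 → Kernel ℝ≥0 ℝ≥0) (ς t : ℝ≥0) (f : ℝ≥0 → ℝ) : ℝ≥0 → ℝ :=
  contS Q (lagU ς t) (lagV t) f

/-- The discrete Laguerre operators `𝕂_t^{(ς)} = 𝕊_{(ς(e^t - 1), e^{-t})}`. -/
def discK (P : ℝ≥0 → Kernel ℕ ℕ) (ς t : ℝ≥0) (f : ℕ → ℝ) : ℕ → ℝ :=
  discS P (lagU ς t) (lagV t) f

/-! ### Invariant probability measures -/

/-- `ν_{β,ς}`: the gamma distribution of shape `β` and scale `ς` on `[0, ∞)`,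
which is the Dirac mass at `0` when `β = 0` or `ς = 0`. -/
def gammaInv (β ς : ℝ≥0) : Measure ℝ≥0 :=
  if 0 < β ∧ 0 < ς then
    (gammaMeasure (β : ℝ) (ς : ℝ)⁻¹).map Real.toNNReal
  else Measure.dirac 0

/-- The weight `𝔫_{β,s}(n) = (1+s)^{-β} (s/(1+s))^n β (β+1) ⋯ (β+n-1) / n!`. -/
def negBinWeight (β s : ℝ≥0) (n : ℕ) : ℝ :=
  (1 + (s : ℝ)) ^ (-(β : ℝ)) * ((s : ℝ) / (1 + (s : ℝ))) ^ n *
    ((∏ i ∈ Finset.range n, ((β : ℝ) + (i : ℝ))) / (n.factorial : ℝ))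

/-- `𝔫_{β,s}`: the negative binomial distribution of parameters `β` and `s/(1+s)`. -/
def negBinInv (β s : ℝ≥0) : Measure ℕ :=
  Measure.sum fun n => ENNReal.ofReal (negBinWeight β s n) • Measure.dirac n

end

/-!
The kernels of both semigroups are identified through exponential functions. On a Feller semigroup
the Cauchy problem for the generator has a unique solution in `C₀`
(`IsFellerSemigroup.act_eq_of_hasDerivAt`). The functions `x ↦ exp (- l x)` on `ℝ₊` and `n ↦ z ^ n`
on `ℤ₊` are limits of test functions in the graph norm, so they lie in the domain of the (closed)
generator, and each generator moves them along a curve `l(t) = l / (1 + l t)`, where `l = 1 - z` in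
the discrete case. This gives the Laplace transform of `Q_t(x, ·)`
(`IsSquaredBesselSemigroup.integral_exp`) and the generating function of `ℚ_t(n, ·)`
(`IsLinearBirthDeathSemigroup.integral_pow`). Since Laplace transforms determine finite measures
(`measure_ext_of_laplace`), the relation `Q_u Λ_σ = Λ_σ ℚ_{σu}` holds as an identity of kernels
(`birthDeath_comp_poissonDilKernel`).

The dilations enter through `Λ 𝔻_v = d_v Λ` (`poisson_thinning`), which is a Cauchy product of
Poisson series and holds for all `v`. Combined with the kernel identity it yields the intertwining
relation with `𝔻_v ℚ_{vσu}` without restriction, and with `ℚ_{σu} 𝔻_v` wherever Fubini's theorem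
applies. For `2 σ u (v - 1) < 1` it applies everywhere: by its generating function, `ℚ_s(n, ·)` is
a mixture of shifted negative binomial laws (`birthDeathLaw`), hence integrates `z ^ k` for
`|z| < (1 + s) / s`, which dominates the growth of `𝔻_v f` for bounded `f`. In that range
`ℚ_s 𝔻_v = 𝔻_v ℚ_{vs}` (`discS_eq_discDil_kernelAct`), because both sides are summable
combinations of the values of `f` and agree on `n ↦ z ^ n`.

For `v ≤ 1` all operators are Markov, and Laplace transforms show that the gamma law is invariant
for `K_t` and is mapped by `Λ_σ` to the negative binomial law, which is therefore invariant for
`𝕂_t`. By Jensen's inequality a Markov kernel induces a contraction between the `L²` spaces of the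
corresponding laws (`markovLp`), and identities of kernels become identities of operators.

The unitary operator is not obtained from `Λ_σ` by a polar decomposition but from explicit total
families. The generating functions of the Laguerre and the Meixner polynomials, with parameter `r`,
are exponentials and powers on which `K_t` and `𝕂_t` act by `r ↦ e ^ (-t) r`; their Gram matrices
are `(1 - r q) ^ (-β)` and `(1 - r q (1 + s) / s) ^ (-β)` with `s = ς σ`. After rescaling `r` by
`√(s / (1 + s))` in the second family the Gram matrices agree, so some unitary operator exchanges
the families (`exists_linearIsometryEquiv_of_inner_eq`) and intertwines the semigroups
(`exists_unitary_laguerre`).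
-/

/-! ### Feller semigroups as contraction semigroups on `C₀` -/

lemma ZeroAtInftyContinuousMap.norm_apply_le {E : Type*} [TopologicalSpace E] (f : C₀(E, ℝ))
    (x : E) : |f x| ≤ ‖f‖ :=
  f.toBCF.norm_coe_le_norm x

lemma ZeroAtInftyContinuousMap.norm_le_of_forall {E : Type*} [TopologicalSpace E]
    {f : C₀(E, ℝ)} {C : ℝ} (hC : 0 ≤ C) (h : ∀ x, |f x| ≤ C) : ‖f‖ ≤ C :=
  (BoundedContinuousFunction.norm_le (f := f.toBCF) hC).2 h

lemma ZeroAtInftyContinuousMap.integrable {E : Type*} [TopologicalSpace E] [MeasurableSpace E]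
    [BorelSpace E] (f : C₀(E, ℝ)) (μ : Measure E) [IsFiniteMeasure μ] : Integrable f μ :=
  Integrable.of_bound (map_continuous f).measurable.aestronglyMeasurable ‖f‖
    (ae_of_all _ f.norm_apply_le)

namespace IsFellerSemigroup

variable {E : Type*} [TopologicalSpace E] [MeasurableSpace E] {κ : ℝ≥0 → Kernel E E}

/-- The operator `κ_t` on `C₀(E)`. -/
noncomputable def act (h : IsFellerSemigroup κ) (t : ℝ≥0) (f : C₀(E, ℝ)) : C₀(E, ℝ) :=
  (h.feller t f).choose

lemma act_apply (h : IsFellerSemigroup κ) (t : ℝ≥0) (f : C₀(E, ℝ)) (x : E) :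
    h.act t f x = ∫ y, f y ∂(κ t x) :=
  (h.feller t f).choose_spec x

/-- The pair `(f, g)` belongs to the graph of the generator of `κ` on `C₀(E)`. -/
def InGenerator (h : IsFellerSemigroup κ) (f g : C₀(E, ℝ)) : Prop :=
  ∀ ε > 0, ∃ δ > 0, ∀ t : ℝ≥0, (t : ℝ) < δ → ‖h.act t f - f - (t : ℝ) • g‖ ≤ ε * t

lemma act_smul (h : IsFellerSemigroup κ) (t : ℝ≥0) (c : ℝ) (f : C₀(E, ℝ)) :
    h.act t (c • f) = c • h.act t f := by
  ext x
  simp [act_apply, integral_const_mul]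

lemma tendsto_act (h : IsFellerSemigroup κ) (f : C₀(E, ℝ)) :
    Tendsto (fun t => h.act t f) (𝓝 0) (𝓝 f) := by
  rw [ZeroAtInftyContinuousMap.tendsto_iff_tendstoUniformly]
  convert h.strong_continuous f using 2 with t
  ext x
  exact h.act_apply t f x

lemma exists_norm_act_sub_lt (h : IsFellerSemigroup κ) (f : C₀(E, ℝ)) {ε : ℝ} (hε : 0 < ε) :
    ∃ δ > 0, ∀ t : ℝ≥0, (t : ℝ) < δ → ‖h.act t f - f‖ < ε := by
  obtain ⟨δ, hδ, H⟩ := Metric.tendsto_nhds_nhds.1 (h.tendsto_act f) ε hε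
  refine ⟨δ, hδ, fun t ht => ?_⟩
  rw [← dist_eq_norm]
  exact H (by simpa [NNReal.dist_eq] using ht)

lemma norm_act_le (h : IsFellerSemigroup κ) (t : ℝ≥0) (f : C₀(E, ℝ)) : ‖h.act t f‖ ≤ ‖f‖ := by
  have := h.markov t
  refine ZeroAtInftyContinuousMap.norm_le_of_forall (norm_nonneg _) fun x => ?_
  rw [act_apply]
  simpa using norm_integral_le_of_norm_le_const (μ := κ t x) (f := f) (C := ‖f‖)
    (ae_of_all _ f.norm_apply_le)

lemma InGenerator.smul {h : IsFellerSemigroup κ} {f g : C₀(E, ℝ)} (hfg : h.InGenerator f g) (c : ℝ) :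
    h.InGenerator (c • f) (c • g) := by
  intro ε hε
  obtain ⟨δ, hδ, H⟩ := hfg (ε / (|c| + 1)) (by positivity)
  refine ⟨δ, hδ, fun t ht => ?_⟩
  have e : h.act t (c • f) - c • f - (t : ℝ) • c • g = c • (h.act t f - f - (t : ℝ) • g) := by
    rw [h.act_smul]
    ext x
    simp
    ring
  rw [e, norm_smul, Real.norm_eq_abs]
  have h1 := H t ht
  calc |c| * ‖h.act t f - f - (t : ℝ) • g‖ ≤ (|c| + 1) * (ε / (|c| + 1) * t) := by
        gcongr
        linarith
    _ = ε * t := by field_simp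

variable [BorelSpace E]

lemma act_sub (h : IsFellerSemigroup κ) (t : ℝ≥0) (f g : C₀(E, ℝ)) :
    h.act t (f - g) = h.act t f - h.act t g := by
  have := h.markov t
  ext x
  simp only [act_apply, ZeroAtInftyContinuousMap.coe_sub, Pi.sub_apply]
  exact integral_sub (f.integrable _) (g.integrable _)

lemma act_zero_time (h : IsFellerSemigroup κ) (f : C₀(E, ℝ)) : h.act 0 f = f := by
  ext x
  rw [act_apply, h.zero, Kernel.id_apply,
    integral_dirac' _ _ (map_continuous f).measurable.stronglyMeasurable]

lemma act_add (h : IsFellerSemigroup κ) (s t : ℝ≥0) (f : C₀(E, ℝ)) :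
    h.act (s + t) f = h.act s (h.act t f) := by
  have := h.markov t
  have := h.markov s
  ext x
  rw [act_apply, h.add, Kernel.integral_comp (f.integrable _), act_apply]
  simp only [act_apply]

lemma continuous_act (h : IsFellerSemigroup κ) (f : C₀(E, ℝ)) :
    Continuous fun r : ℝ => h.act r.toNNReal f := by
  -- contractivity reduces continuity at every time to continuity at time zero
  have key : ∀ a b : ℝ≥0, b ≤ a → ‖h.act a f - h.act b f‖ ≤ ‖h.act (a - b) f - f‖ := by
    intro a b hab
    conv_lhs => rw [← add_tsub_cancel_of_le hab, h.act_add, ← h.act_sub]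
    exact h.norm_act_le _ _
  suffices H : Continuous fun t : ℝ≥0 => h.act t f from H.comp continuous_real_toNNReal
  rw [Metric.continuous_iff]
  intro b ε hε
  obtain ⟨δ, hδ, H⟩ := h.exists_norm_act_sub_lt f hε
  refine ⟨δ, hδ, fun a hab => ?_⟩
  rw [NNReal.dist_eq, abs_lt] at hab
  rw [dist_eq_norm]
  rcases le_total b a with hle | hle
  · refine (key a b hle).trans_lt (H _ ?_)
    rw [NNReal.coe_sub hle]
    exact hab.2
  · rw [norm_sub_rev]
    refine (key b a hle).trans_lt (H _ ?_)
    rw [NNReal.coe_sub hle]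
    linarith [hab.1]

variable {h : IsFellerSemigroup κ}

lemma InGenerator.hasDerivWithinAt {f g : C₀(E, ℝ)} (hfg : h.InGenerator f g) {r : ℝ}
    (hr : 0 ≤ r) :
    HasDerivWithinAt (fun r : ℝ => h.act r.toNNReal f) (h.act r.toNNReal g) (Set.Ici r) r := by
  rw [hasDerivWithinAt_iff_isLittleO, Asymptotics.isLittleO_iff]
  intro ε hε
  obtain ⟨δ, hδ, H⟩ := hfg ε hε
  rw [eventually_nhdsWithin_iff]
  filter_upwards [Metric.ball_mem_nhds r hδ] with s hs hrs
  rw [Metric.mem_ball, Real.dist_eq, abs_lt] at hs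
  have hrs : r ≤ s := hrs
  have h1 : ((s - r).toNNReal : ℝ) = s - r := Real.coe_toNNReal _ (sub_nonneg.2 hrs)
  have h2 : s.toNNReal = r.toNNReal + (s - r).toNNReal := by
    rw [← Real.toNNReal_add hr (sub_nonneg.2 hrs)]
    congr 1
    ring
  rw [h2, h.act_add, ← h.act_sub, ← h.act_smul, ← h.act_sub]
  refine (h.norm_act_le _ _).trans ?_
  have := H (s - r).toNNReal (by rw [h1]; exact hs.2)
  rw [h1] at this
  rwa [Real.norm_of_nonneg (sub_nonneg.2 hrs)]

/-- The mean value inequality along the semigroup: `κ_t f - f - t g` is small as soon as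
`κ_r g - g` is, uniformly over `r ≤ t`. Unlike membership in the generator, this bound passes to
limits in `(f, g)`. -/
lemma InGenerator.norm_act_sub_sub_le {f g : C₀(E, ℝ)} (hfg : h.InGenerator f g) {t : ℝ≥0}
    {C : ℝ} (hC : ∀ r : ℝ≥0, r < t → ‖h.act r g - g‖ ≤ C) :
    ‖h.act t f - f - (t : ℝ) • g‖ ≤ C * t := by
  have := norm_image_sub_le_of_norm_deriv_right_le_segment
    (f := fun r : ℝ => h.act r.toNNReal f - r • g) (a := 0) (b := t) (C := C)
    (f' := fun r => h.act r.toNNReal g - (1 : ℝ) • g)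
    ((h.continuous_act f).sub (continuous_id.smul continuous_const)).continuousOn
    (fun r hr => (hfg.hasDerivWithinAt hr.1).sub ((hasDerivWithinAt_id r _).smul_const g))
    (fun r hr => by
      rw [one_smul]
      exact hC _ (by rw [← NNReal.coe_lt_coe, Real.coe_toNNReal _ hr.1]; exact hr.2))
    t (Set.right_mem_Icc.2 t.2)
  simpa [h.act_zero_time, sub_right_comm] using this

/-- The generator is closed. -/
lemma inGenerator_of_forall_exists {f g : C₀(E, ℝ)}
    (H : ∀ ε > 0, ∃ f' g' : C₀(E, ℝ), h.InGenerator f' g' ∧ ‖f' - f‖ ≤ ε ∧ ‖g' - g‖ ≤ ε) :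
    h.InGenerator f g := by
  intro ε hε
  obtain ⟨δ, hδ, hδ'⟩ := h.exists_norm_act_sub_lt g hε
  refine ⟨δ, hδ, fun t ht => ?_⟩
  refine le_of_forall_pos_le_add fun η hη => ?_
  obtain ⟨θ, hθ, hθη⟩ : ∃ θ > 0, θ * (2 + 3 * t) ≤ η :=
    ⟨η / (2 + 3 * t), by positivity, by rw [div_mul_cancel₀ _ (by positivity)]⟩
  obtain ⟨f', g', hfg, hf, hg⟩ := H θ hθ
  have h1 : ‖h.act t f' - f' - (t : ℝ) • g'‖ ≤ (ε + 2 * θ) * t := by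
    refine hfg.norm_act_sub_sub_le fun r hr => ?_
    have e : h.act r g' - g' = h.act r (g' - g) + (h.act r g - g) - (g' - g) := by
      rw [h.act_sub]; abel
    rw [e]
    refine (norm_sub_le _ _).trans ?_
    have := norm_add_le (h.act r (g' - g)) (h.act r g - g)
    have := h.norm_act_le r (g' - g)
    have := hδ' r ((NNReal.coe_lt_coe.2 hr).trans ht)
    linarith
  have e : h.act t f - f - (t : ℝ) • g = (h.act t f' - f' - (t : ℝ) • g')
      - h.act t (f' - f) + (f' - f) + (t : ℝ) • (g' - g) := by
    have e1 : (t : ℝ) • (g' - g) = (t : ℝ) • g' - (t : ℝ) • g := by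
      ext x; simp [mul_sub]
    rw [h.act_sub, e1]; abel
  rw [e]
  have h2 : ‖(t : ℝ) • (g' - g)‖ ≤ t * θ := by
    rw [norm_smul, Real.norm_of_nonneg t.coe_nonneg]
    gcongr
  have h3 := h.norm_act_le t (f' - f)
  have h4 := norm_add_le (h.act t f' - f' - (t : ℝ) • g' - h.act t (f' - f) + (f' - f))
    ((t : ℝ) • (g' - g))
  have h5 := norm_add_le (h.act t f' - f' - (t : ℝ) • g' - h.act t (f' - f)) (f' - f)
  have h6 := norm_sub_le (h.act t f' - f' - (t : ℝ) • g') (h.act t (f' - f))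
  linarith

lemma InGenerator.of_generatorMaps {f g : C₀(E, ℝ)} (hfg : GeneratorMaps κ f g) :
    h.InGenerator f g := by
  intro ε hε
  have := Metric.tendstoUniformly_iff.1 hfg ε hε
  rw [eventually_nhdsWithin_iff] at this
  obtain ⟨δ, hδ, H⟩ := Metric.eventually_nhds_iff.1 this
  refine ⟨δ, hδ, fun t ht => ?_⟩
  rcases eq_or_ne t 0 with rfl | h0
  · simp [h.act_zero_time]
  have ht0 : 0 < t := pos_iff_ne_zero.2 h0
  refine ZeroAtInftyContinuousMap.norm_le_of_forall (by positivity) fun x => ?_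
  have h1 := (H (y := t) (by simpa [NNReal.dist_eq] using ht) ht0 x).le
  rw [Real.dist_eq, abs_sub_comm] at h1
  have ht0' : (0 : ℝ) < t := ht0
  have h2 : (h.act t f - f - (t : ℝ) • g) x
      = ((kernelAct (κ t) f x - f x) / t - g x) * t := by
    simp only [ZeroAtInftyContinuousMap.coe_sub, Pi.sub_apply, act_apply,
      ZeroAtInftyContinuousMap.coe_smul, Pi.smul_apply, smul_eq_mul, kernelAct]
    field_simp
  rw [h2, abs_mul, abs_of_pos ht0']
  gcongr

/-- Uniqueness for the Cauchy problem `F' = A F` in `C₀(E)`. The path `s ↦ κ_{t-s} F_s` has zero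
right derivative because `κ_{t-s-δ}` is a contraction and `F_{s+δ} - κ_δ F_s = o(δ)`. -/
lemma act_eq_of_hasDerivAt {F G : ℝ → C₀(E, ℝ)} (hF : ∀ s, 0 ≤ s → HasDerivAt F (G s) s)
    (hFG : ∀ s, 0 ≤ s → h.InGenerator (F s) (G s)) (t : ℝ≥0) : h.act t (F 0) = F t := by
  set H : ℝ → C₀(E, ℝ) := fun s => h.act (t - s).toNNReal (F s) with hH
  have step : ∀ s s' : ℝ, 0 ≤ s → s ≤ s' → s' ≤ t →
      ‖H s' - H s‖ ≤ ‖F s' - h.act (s' - s).toNNReal (F s)‖ := by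
    intro s s' _ h2 h3
    have e : (t - s).toNNReal = (t - s').toNNReal + (s' - s).toNNReal := by
      rw [← Real.toNNReal_add (by linarith) (by linarith)]
      congr 1
      ring
    simp only [hH]
    rw [e, h.act_add, ← h.act_sub]
    exact h.norm_act_le _ _
  have hderiv : ∀ s ∈ Set.Ico (0 : ℝ) t, HasDerivWithinAt H 0 (Set.Ici s) s := by
    rintro s ⟨h0, h1⟩
    rw [hasDerivWithinAt_iff_isLittleO, Asymptotics.isLittleO_iff]
    intro ε hε
    have hd := (hasDerivAt_iff_isLittleO.1 (hF s h0))
    rw [Asymptotics.isLittleO_iff] at hd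
    have hd := hd (half_pos hε)
    obtain ⟨δ, hδ, hδ'⟩ := hFG s h0 (ε / 2) (half_pos hε)
    rw [eventually_nhdsWithin_iff]
    filter_upwards [hd, Metric.ball_mem_nhds s hδ, Iio_mem_nhds h1] with s' hs' hb hlt hge
    have hge : s ≤ s' := hge
    rw [Metric.mem_ball, Real.dist_eq, abs_lt] at hb
    have e1 : ((s' - s).toNNReal : ℝ) = s' - s := Real.coe_toNNReal _ (sub_nonneg.2 hge)
    have h3 := hδ' (s' - s).toNNReal (by rw [e1]; exact hb.2)
    rw [e1] at h3
    rw [Real.norm_of_nonneg (sub_nonneg.2 hge)] at hs' ⊢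
    rw [smul_zero, sub_zero]
    refine (step s s' h0 hge (le_of_lt hlt)).trans ?_
    have e2 : F s' - h.act (s' - s).toNNReal (F s) = (F s' - F s - (s' - s) • G s)
        - (h.act (s' - s).toNNReal (F s) - F s - (s' - s) • G s) := by abel
    rw [e2]
    refine (norm_sub_le _ _).trans ?_
    linarith
  have hcont : ContinuousOn H (Set.Icc 0 t) := by
    rintro s ⟨h0, h1⟩
    have hFc : ContinuousAt F s := (hF s h0).continuousAt
    rw [Metric.continuousWithinAt_iff]
    intro ε hε
    obtain ⟨δ₁, hδ₁, hd₁⟩ := Metric.continuousAt_iff.1 hFc (ε / 3) (by positivity)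
    obtain ⟨δ₂, hδ₂, hd₂⟩ := h.exists_norm_act_sub_lt (F s) (ε := ε / 3) (by positivity)
    refine ⟨min δ₁ δ₂, lt_min hδ₁ hδ₂, ?_⟩
    rintro s' ⟨h0', h1'⟩ hs'
    have hF' : ‖F s' - F s‖ < ε / 3 := by
      rw [← dist_eq_norm]
      exact hd₁ (hs'.trans_le (min_le_left _ _))
    have hs'' : |s' - s| < δ₂ := hs'.trans_le (min_le_right _ _)
    rw [abs_lt] at hs''
    rw [dist_eq_norm]
    rcases le_total s s' with hle | hle
    · refine (step s s' h0 hle h1').trans_lt ?_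
      have h3 := hd₂ (s' - s).toNNReal
        (by rw [Real.coe_toNNReal _ (sub_nonneg.2 hle)]; exact hs''.2)
      have e2 : F s' - h.act (s' - s).toNNReal (F s) = (F s' - F s)
        - (h.act (s' - s).toNNReal (F s) - F s) := by abel
      rw [e2]
      refine (norm_sub_le _ _).trans_lt ?_
      linarith
    · rw [norm_sub_rev]
      refine (step s' s h0' hle h1).trans_lt ?_
      have h3 := hd₂ (s - s').toNNReal
        (by rw [Real.coe_toNNReal _ (sub_nonneg.2 hle)]; linarith [hs''.1])
      have e2 : F s - h.act (s - s').toNNReal (F s') = h.act (s - s').toNNReal (F s - F s')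
        - (h.act (s - s').toNNReal (F s) - F s) := by
        rw [h.act_sub]; abel
      rw [e2]
      refine (norm_sub_le _ _).trans_lt ?_
      have := h.norm_act_le (s - s').toNNReal (F s - F s')
      rw [norm_sub_rev] at hF'
      linarith
  have := constant_of_has_deriv_right_zero hcont hderiv t (Set.right_mem_Icc.2 t.2)
  simpa [hH, h.act_zero_time] using this.symm

end IsFellerSemigroup

/-! ### The exponential family in `C₀` -/

open Classical in
/-- A function that is continuous and vanishes at infinity, as an element of `C₀(E)`; all other
functions are sent to `0`. -/
noncomputable def ofFunC₀ {E : Type*} [TopologicalSpace E] (f : E → ℝ) : C₀(E, ℝ) :=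
  if h : Continuous f ∧ Tendsto f (cocompact E) (𝓝 0) then ⟨⟨f, h.1⟩, h.2⟩ else 0

lemma coe_ofFunC₀ {E : Type*} [TopologicalSpace E] {f : E → ℝ} (h1 : Continuous f)
    (h2 : Tendsto f (cocompact E) (𝓝 0)) : ⇑(ofFunC₀ f) = f := by
  rw [ofFunC₀, dif_pos ⟨h1, h2⟩]
  rfl

/-- A continuous nonnegative function tending to infinity at infinity; it is `x ↦ x` on `ℝ₊`
and on `ℤ₊` in the applications. -/
structure IsProperNonneg {E : Type*} [TopologicalSpace E] (X : E → ℝ) : Prop where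
  continuous : Continuous X
  nonneg : ∀ x, 0 ≤ X x
  tendsto : Tendsto X (cocompact E) atTop

lemma isProperNonneg_nnreal : IsProperNonneg (fun x : ℝ≥0 => (x : ℝ)) where
  continuous := NNReal.continuous_coe
  nonneg x := x.2
  tendsto := by
    have h : Tendsto (fun x : ℝ≥0 => (x : ℝ)) (cocompact ℝ≥0) (cocompact ℝ) :=
      (NNReal.isClosedEmbedding_coe).tendsto_cocompact
    refine (tendsto_norm_cocompact_atTop.comp h).congr fun x => ?_
    simp

lemma isProperNonneg_nat : IsProperNonneg (fun n : ℕ => (n : ℝ)) where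
  continuous := continuous_of_discreteTopology
  nonneg n := n.cast_nonneg
  tendsto := by
    rw [cocompact_eq_cofinite, Nat.cofinite_eq_atTop]
    exact tendsto_natCast_atTop_atTop

lemma pow_mul_exp_neg_le {x l : ℝ} (hx : 0 ≤ x) (hl : 0 < l) (k : ℕ) :
    x ^ k * Real.exp (-(l * x)) ≤ k.factorial / l ^ k := by
  have h := Real.pow_div_factorial_le_exp (l * x) (by positivity) k
  rw [Real.exp_neg, ← div_eq_mul_inv, div_le_div_iff₀ (Real.exp_pos _) (by positivity)]
  rw [div_le_iff₀ (by positivity), mul_pow] at h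
  linarith

lemma abs_exp_sub_one_sub_le (y : ℝ) : |Real.exp y - 1 - y| ≤ y ^ 2 * Real.exp |y| := by
  have h := Complex.norm_exp_sub_sum_le_norm_mul_exp (y : ℂ) 2
  simp only [Finset.sum_range_succ, Finset.range_zero, Finset.sum_empty, pow_zero,
    Nat.factorial_zero, Nat.cast_one, div_one, zero_add, pow_one, Nat.factorial_one,
    Complex.norm_real, Real.norm_eq_abs, sq_abs] at h
  have e : |Real.exp y - 1 - y| = ‖Complex.exp y - (1 + y)‖ := by
    rw [← sub_sub, ← Real.norm_eq_abs, ← Complex.norm_real]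
    push_cast
    rfl
  rwa [e]

/-- The function `X ^ k * exp (- l X)` in `C₀(E)`. -/
noncomputable def expC₀ {E : Type*} [TopologicalSpace E] (X : E → ℝ) (k : ℕ) (l : ℝ) : C₀(E, ℝ) :=
  ofFunC₀ fun x => X x ^ k * Real.exp (-(l * X x))

section

variable {E : Type*} [TopologicalSpace E] {X : E → ℝ}

lemma coe_expC₀ (hX : IsProperNonneg X) (k : ℕ) {l : ℝ} (hl : 0 < l) :
    ⇑(expC₀ X k l) = fun x => X x ^ k * Real.exp (-(l * X x)) := by
  refine coe_ofFunC₀ ?_ ?_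
  · have := hX.continuous
    fun_prop
  · have h := (Real.tendsto_pow_mul_exp_neg_atTop_nhds_zero k).comp (hX.tendsto.const_mul_atTop hl)
    have h' := h.const_mul (1 / l ^ k)
    rw [mul_zero] at h'
    refine h'.congr fun x => ?_
    simp only [Function.comp_apply, mul_pow]
    field_simp

/-- The exponential family is differentiable in `l` for the supremum norm: the second-order
Taylor remainder is controlled by the next moments, uniformly in `x`. -/
lemma hasDerivAt_expC₀ (hX : IsProperNonneg X) (k : ℕ) {l : ℝ} (hl : 0 < l) :
    HasDerivAt (expC₀ X k) (-expC₀ X (k + 1) l) l := by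
  rw [hasDerivAt_iff_isLittleO, Asymptotics.isLittleO_iff]
  intro ε hε
  -- `C` bounds `X ^ (k + 2) * exp (- l X / 2)`; half of the decay rate absorbs `exp (|m - l| X)`
  set C : ℝ := (k + 2).factorial / (l / 2) ^ (k + 2) with hC
  have hCpos : 0 < C := by positivity
  filter_upwards [Metric.ball_mem_nhds l (half_pos hl),
    Metric.ball_mem_nhds l (div_pos hε hCpos)] with m h1 h2
  rw [Metric.mem_ball, Real.dist_eq] at h1 h2
  have hm : 0 < m := by linarith [(abs_lt.1 h1).1]
  rw [lt_div_iff₀ hCpos] at h2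
  refine ZeroAtInftyContinuousMap.norm_le_of_forall (by positivity) fun x => ?_
  have hx := hX.nonneg x
  have e : (expC₀ X k m - expC₀ X k l - (m - l) • -expC₀ X (k + 1) l) x
      = X x ^ k * Real.exp (-(l * X x)) *
        (Real.exp (-((m - l) * X x)) - 1 - (-((m - l) * X x))) := by
    simp only [ZeroAtInftyContinuousMap.coe_sub, Pi.sub_apply, ZeroAtInftyContinuousMap.coe_smul,
      Pi.smul_apply, ZeroAtInftyContinuousMap.coe_neg, Pi.neg_apply, smul_eq_mul,
      coe_expC₀ hX _ hl, coe_expC₀ hX _ hm]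
    have : Real.exp (-(m * X x)) = Real.exp (-(l * X x)) * Real.exp (-((m - l) * X x)) := by
      rw [← Real.exp_add]
      congr 1
      ring
    rw [this]
    ring
  rw [e, abs_mul, abs_of_nonneg (by positivity)]
  calc X x ^ k * Real.exp (-(l * X x)) *
        |Real.exp (-((m - l) * X x)) - 1 - (-((m - l) * X x))|
      ≤ X x ^ k * Real.exp (-(l * X x)) *
        ((-((m - l) * X x)) ^ 2 * Real.exp |-((m - l) * X x)|) := by
        gcongr
        exact abs_exp_sub_one_sub_le _
    _ ≤ X x ^ k * Real.exp (-(l * X x)) *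
        ((-((m - l) * X x)) ^ 2 * Real.exp (l / 2 * X x)) := by
        rw [abs_neg, abs_mul, abs_of_nonneg hx]
        gcongr
    _ = |m - l| ^ 2 * (X x ^ (k + 2) * Real.exp (-(l / 2 * X x))) := by
        have : Real.exp (-(l / 2 * X x)) = Real.exp (-(l * X x)) * Real.exp (l / 2 * X x) := by
          rw [← Real.exp_add]
          congr 1
          ring
        rw [this, sq_abs]
        ring
    _ ≤ |m - l| ^ 2 * C := by
        gcongr
        exact pow_mul_exp_neg_le hx (half_pos hl) _
    _ = |m - l| * C * |m - l| := by ring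
    _ ≤ ε * ‖m - l‖ := by
        rw [Real.norm_eq_abs]
        gcongr

end

/-! ### Laplace transforms of the squared Bessel kernels -/

section SquaredBessel

variable {β : ℝ≥0} {Q : ℝ≥0 → Kernel ℝ≥0 ℝ≥0}

lemma hasDerivAt_exp_neg_mul_comp {lam ε x b b' : ℝ} {ψ : ℝ → ℝ} (hb : ψ (ε * x) = b)
    (h : HasDerivAt ψ b' (ε * x)) :
    HasDerivAt (fun x => Real.exp (-(lam * x)) * ψ (ε * x))
      (Real.exp (-(lam * x)) * (-lam * b + ε * b')) x := by
  have h1 : HasDerivAt (fun x : ℝ => Real.exp (-(lam * x))) (Real.exp (-(lam * x)) * (-lam)) x := by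
    have := ((hasDerivAt_id x).const_mul lam).neg.exp
    simpa using this
  have h2 : HasDerivAt (fun x => ψ (ε * x)) (b' * ε) x := by
    have h3 : HasDerivAt (fun x : ℝ => ε * x) ε x := by
      simpa using (hasDerivAt_id x).const_mul ε
    exact HasDerivAt.comp x h h3
  refine (h1.mul h2).congr_deriv ?_
  rw [hb]
  ring

/-- The exponentials are limits, together with their images, of the test functions
`exp (- l x) χ (ε x)` with `χ` a smooth cutoff, so they belong to the domain of the generator. -/
lemma IsSquaredBesselSemigroup.inGenerator_exp (hQ : IsSquaredBesselSemigroup β Q) {l : ℝ}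
    (hl : 0 < l) :
    hQ.isFeller.InGenerator (expC₀ (fun x : ℝ≥0 => (x : ℝ)) 0 l)
      (l ^ 2 • expC₀ (fun x : ℝ≥0 => (x : ℝ)) 1 l
        - (β * l) • expC₀ (fun x : ℝ≥0 => (x : ℝ)) 0 l) := by
  set χ : ContDiffBump (0 : ℝ) := ⟨1, 2, one_pos, one_lt_two⟩ with hχ
  have hχs : ContDiff ℝ ∞ (χ : ℝ → ℝ) := χ.contDiff
  have hχc : HasCompactSupport (χ : ℝ → ℝ) := χ.hasCompactSupport
  have hd1 : ContDiff ℝ ∞ (deriv χ) := hχs.deriv' (n := ∞)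
  have hd2 : ContDiff ℝ ∞ (deriv (deriv χ)) := hd1.deriv' (n := ∞)
  obtain ⟨C₁, hC₁⟩ := hd1.continuous.bounded_above_of_compact_support hχc.deriv
  obtain ⟨C₂, hC₂⟩ := hd2.continuous.bounded_above_of_compact_support hχc.deriv.deriv
  have hC₁0 : 0 ≤ C₁ := (norm_nonneg _).trans (hC₁ 0)
  have hC₂0 : 0 ≤ C₂ := (norm_nonneg _).trans (hC₂ 0)
  have hχ1 : ∀ y : ℝ, 0 ≤ y → |χ y - 1| ≤ y := by
    intro y hy
    rw [abs_le]
    rcases le_total y 1 with h | h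
    · rw [χ.one_of_mem_closedBall (by simpa [abs_of_nonneg hy] using h)]
      constructor <;> linarith
    · constructor <;> linarith [χ.nonneg (x := y), χ.le_one (x := y)]
  refine IsFellerSemigroup.inGenerator_of_forall_exists fun η hη => ?_
  -- the error made by the cutoff at scale `ε ≤ 1` is at most `K ε`
  set K : ℝ := 1 / l + (l ^ 2 * (2 / l ^ 2) + 2 * l * C₁ * (1 / l) + C₂ * (1 / l)
    + β * l * (1 / l) + β * C₁) with hK
  have hKpos : 0 < K := by positivity
  set ε : ℝ := min 1 (η / K) with hε
  have hε0 : 0 < ε := by positivity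
  have hε1 : ε ≤ 1 := min_le_left _ _
  have hεK : ε * K ≤ η := by
    rw [← le_div_iff₀ hKpos]
    exact min_le_right _ _
  set φ : ℝ → ℝ := fun x => Real.exp (-(l * x)) * χ (ε * x) with hφ
  have hφs : ContDiff ℝ ∞ φ := by fun_prop
  have hφc : HasCompactSupport φ := by
    refine HasCompactSupport.mul_left ?_
    exact hχc.comp_homeomorph (Homeomorph.mulLeft₀ ε hε0.ne')
  have hφ1 : deriv φ = fun x => Real.exp (-(l * x)) * (-l * χ (ε * x) + ε * deriv χ (ε * x)) := by
    ext x
    exact (hasDerivAt_exp_neg_mul_comp rfl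
      (hχs.differentiable (by simp) _).hasDerivAt).deriv
  have hφ2 : deriv (deriv φ) = fun x => Real.exp (-(l * x)) *
      (l ^ 2 * χ (ε * x) - 2 * l * ε * deriv χ (ε * x) + ε ^ 2 * deriv (deriv χ) (ε * x)) := by
    rw [hφ1]
    ext x
    have := (hasDerivAt_exp_neg_mul_comp (lam := l) (ε := ε) (x := x)
      (ψ := fun y => -l * χ y + ε * deriv χ y) rfl
      (((hχs.differentiable (by simp) _).hasDerivAt.const_mul (-l)).add
        ((hd1.differentiable (by simp) _).hasDerivAt.const_mul ε))).deriv
    rw [this]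
    ring
  have hd1φ : Continuous (deriv φ) := (hφs.deriv' (n := ∞)).continuous
  have hd2φ : Continuous (deriv (deriv φ)) := ((hφs.deriv' (n := ∞)).deriv' (n := ∞)).continuous
  have hcf : ⇑(ofFunC₀ fun x : ℝ≥0 => φ x) = fun x : ℝ≥0 => φ x := by
    refine coe_ofFunC₀ (hφs.continuous.comp NNReal.continuous_coe) ?_
    exact (hφc.comp_isClosedEmbedding NNReal.isClosedEmbedding_coe).is_zero_at_infty
  have hcg : ⇑(ofFunC₀ fun x : ℝ≥0 => (x : ℝ) * deriv (deriv φ) x + (β : ℝ) * deriv φ x)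
      = fun x : ℝ≥0 => (x : ℝ) * deriv (deriv φ) x + (β : ℝ) * deriv φ x := by
    refine coe_ofFunC₀ (by fun_prop) ?_
    have : HasCompactSupport fun x : ℝ => x * deriv (deriv φ) x + (β : ℝ) * deriv φ x :=
      hφc.deriv.deriv.mul_left.add hφc.deriv.mul_left
    exact (this.comp_isClosedEmbedding NNReal.isClosedEmbedding_coe).is_zero_at_infty
  have hX := isProperNonneg_nnreal
  refine ⟨_, _, IsFellerSemigroup.InGenerator.of_generatorMaps
    (f := ofFunC₀ fun x : ℝ≥0 => φ x)
    (g := ofFunC₀ fun x : ℝ≥0 => (x : ℝ) * deriv (deriv φ) x + (β : ℝ) * deriv φ x)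
    (by rw [hcf, hcg]; exact hQ.generator φ hφs hφc), ?_, ?_⟩
  · refine ZeroAtInftyContinuousMap.norm_le_of_forall hη.le fun x => ?_
    have e : (ofFunC₀ (fun x : ℝ≥0 => φ x) - expC₀ (fun x : ℝ≥0 => (x : ℝ)) 0 l) x
        = Real.exp (-(l * x)) * (χ (ε * x) - 1) := by
      rw [ZeroAtInftyContinuousMap.coe_sub, Pi.sub_apply, hcf, coe_expC₀ hX _ hl]
      simp only [hφ]
      ring
    rw [e, abs_mul, abs_of_pos (Real.exp_pos _)]
    have hx := x.coe_nonneg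
    calc Real.exp (-(l * x)) * |χ (ε * x) - 1| ≤ Real.exp (-(l * x)) * (ε * x) := by
          gcongr
          exact hχ1 _ (by positivity)
      _ = ε * ((x : ℝ) ^ 1 * Real.exp (-(l * x))) := by ring
      _ ≤ ε * (1 / l) := by
          gcongr
          simpa using pow_mul_exp_neg_le hx hl 1
      _ ≤ ε * K := by
          gcongr
          rw [hK]
          exact le_add_of_nonneg_right (by positivity)
      _ ≤ η := hεK
  · refine ZeroAtInftyContinuousMap.norm_le_of_forall hη.le fun x => ?_
    have hx := x.coe_nonneg
    have e : (ofFunC₀ (fun x : ℝ≥0 => (x : ℝ) * deriv (deriv φ) x + (β : ℝ) * deriv φ x)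
        - (l ^ 2 • expC₀ (fun x : ℝ≥0 => (x : ℝ)) 1 l
        - (β * l) • expC₀ (fun x : ℝ≥0 => (x : ℝ)) 0 l)) x
        = Real.exp (-(l * x)) * (l ^ 2 * x * (χ (ε * x) - 1) - 2 * l * ε * x * deriv χ (ε * x)
          + ε ^ 2 * x * deriv (deriv χ) (ε * x) - β * l * (χ (ε * x) - 1)
          + β * ε * deriv χ (ε * x)) := by
      rw [ZeroAtInftyContinuousMap.coe_sub, Pi.sub_apply, hcg, hφ2, hφ1]
      simp only [ZeroAtInftyContinuousMap.coe_sub, Pi.sub_apply, coe_expC₀ hX _ hl,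
        ZeroAtInftyContinuousMap.coe_smul, Pi.smul_apply, smul_eq_mul]
      ring
    rw [e, abs_mul, abs_of_pos (Real.exp_pos _)]
    have a0 := hχ1 (ε * x) (by positivity)
    have a1 := hC₁ (ε * x)
    have a2 := hC₂ (ε * x)
    rw [Real.norm_eq_abs] at a1 a2
    have b : |l ^ 2 * x * (χ (ε * x) - 1) - 2 * l * ε * x * deriv χ (ε * x)
          + ε ^ 2 * x * deriv (deriv χ) (ε * x) - β * l * (χ (ε * x) - 1)
          + β * ε * deriv χ (ε * x)|
        ≤ l ^ 2 * x * (ε * x) + 2 * l * ε * x * C₁ + ε * x * C₂ + β * l * (ε * x)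
          + β * ε * C₁ := by
      refine (abs_add_le _ _).trans (add_le_add ((abs_sub _ _).trans (add_le_add
        ((abs_add_le _ _).trans (add_le_add ((abs_sub _ _).trans (add_le_add ?_ ?_)) ?_)) ?_)) ?_)
      all_goals rw [abs_mul, abs_of_nonneg (by positivity)]
      · gcongr
      · gcongr
      · gcongr
        nlinarith
      · gcongr
      · gcongr
    have p0 : Real.exp (-(l * x)) ≤ 1 := by simpa using pow_mul_exp_neg_le hx hl 0
    have p1 : x * Real.exp (-(l * x)) ≤ 1 / l := by simpa using pow_mul_exp_neg_le hx hl 1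
    have p2 : (x : ℝ) ^ 2 * Real.exp (-(l * x)) ≤ 2 / l ^ 2 := by
      simpa using pow_mul_exp_neg_le hx hl 2
    calc _ ≤ Real.exp (-(l * x)) * (l ^ 2 * x * (ε * x) + 2 * l * ε * x * C₁ + ε * x * C₂
            + β * l * (ε * x) + β * ε * C₁) := by gcongr
      _ = ε * (l ^ 2 * (x ^ 2 * Real.exp (-(l * x))) + 2 * l * C₁ * (x * Real.exp (-(l * x)))
            + C₂ * (x * Real.exp (-(l * x))) + β * l * (x * Real.exp (-(l * x)))
            + β * C₁ * Real.exp (-(l * x))) := by ring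
      _ ≤ ε * (l ^ 2 * (2 / l ^ 2) + 2 * l * C₁ * (1 / l) + C₂ * (1 / l)
            + β * l * (1 / l) + β * C₁ * 1) := by gcongr
      _ ≤ ε * K := by
          gcongr
          rw [hK, mul_one]
          exact le_add_of_nonneg_left (by positivity)
      _ ≤ η := hεK

lemma hasDerivAt_one_add_mul_rpow (b : ℝ) {w s : ℝ} (hs : 0 < 1 + w * s) :
    HasDerivAt (fun s : ℝ => (1 + w * s) ^ (-b))
      (-(b * (w / (1 + w * s))) * (1 + w * s) ^ (-b)) s := by
  have h1 : HasDerivAt (fun s : ℝ => 1 + w * s) w s := by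
    simpa using ((hasDerivAt_id s).const_mul w).const_add 1
  refine (h1.rpow_const (p := -b) (Or.inl hs.ne')).congr_deriv ?_
  rw [Real.rpow_sub_one hs.ne']
  ring

lemma hasDerivAt_div_one_add_mul {w s : ℝ} (hs : 0 < 1 + w * s) :
    HasDerivAt (fun s : ℝ => w / (1 + w * s)) (-(w / (1 + w * s)) ^ 2) s := by
  have h1 : HasDerivAt (fun s : ℝ => 1 + w * s) w s := by
    simpa using ((hasDerivAt_id s).const_mul w).const_add 1
  refine ((hasDerivAt_const s w).div h1 hs.ne').congr_deriv ?_
  field_simp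
  ring

/-- The Laplace transform of the squared Bessel kernels. The function of `t` on the right solves
the Cauchy problem in `C₀` because `l ↦ l / (1 + l t)` and `(1 + l t) ^ (-β)` solve the
characteristic equations `l' = - l ^ 2` and `c' = - β l c`. -/
lemma IsSquaredBesselSemigroup.integral_exp (hQ : IsSquaredBesselSemigroup β Q) (t x : ℝ≥0)
    {l : ℝ} (hl : 0 < l) :
    ∫ y, Real.exp (-(l * y)) ∂(Q t x)
      = (1 + l * t) ^ (-(β : ℝ)) * Real.exp (-(l / (1 + l * t) * x)) := by
  have hX := isProperNonneg_nnreal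
  have h1 : ∀ s : ℝ, 0 ≤ s → 0 < 1 + l * s := fun s hs => by positivity
  have key := IsFellerSemigroup.act_eq_of_hasDerivAt (h := hQ.isFeller)
    (F := fun s => (1 + l * s) ^ (-(β : ℝ)) • expC₀ (fun x : ℝ≥0 => (x : ℝ)) 0 (l / (1 + l * s)))
    (G := fun s => (1 + l * s) ^ (-(β : ℝ)) • ((l / (1 + l * s)) ^ 2 •
        expC₀ (fun x : ℝ≥0 => (x : ℝ)) 1 (l / (1 + l * s))
        - (β * (l / (1 + l * s))) • expC₀ (fun x : ℝ≥0 => (x : ℝ)) 0 (l / (1 + l * s))))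
    (fun s hs => by
      have hpos : 0 < l / (1 + l * s) := div_pos hl (h1 s hs)
      refine ((hasDerivAt_one_add_mul_rpow β (h1 s hs)).smul ((hasDerivAt_expC₀ hX 0 hpos).scomp s
        (hasDerivAt_div_one_add_mul (h1 s hs)))).congr_deriv ?_
      ext y
      simp
      ring)
    (fun s hs => (hQ.inGenerator_exp (div_pos hl (h1 s hs))).smul _) t
  have := congrArg (fun f : C₀(ℝ≥0, ℝ) => f x) key
  simp only [mul_zero, add_zero, Real.one_rpow, one_smul, div_one] at this
  rw [IsFellerSemigroup.act_apply] at this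
  simpa [coe_expC₀ hX _ hl, coe_expC₀ hX _ (div_pos hl (h1 t t.2))] using this

end SquaredBessel

/-! ### Generating functions of the birth-death kernels -/

section BirthDeath

variable {β : ℝ≥0} {P : ℝ≥0 → Kernel ℕ ℕ}

lemma exp_neg_mul_natCast (l : ℝ) (n : ℕ) : Real.exp (-(l * n)) = Real.exp (-l) ^ n := by
  rw [← Real.exp_nat_mul]
  congr 1
  ring

lemma tendsto_zero_cocompact_of_finite_support {f : ℕ → ℝ} (hf : f.support.Finite) :
    Tendsto f (cocompact ℕ) (𝓝 0) := by
  rw [cocompact_eq_cofinite]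
  refine tendsto_const_nhds.congr' ?_
  filter_upwards [hf.compl_mem_cofinite] with n hn
  exact (Function.notMem_support.1 hn).symm

/-- The functions `n ↦ z ^ n`, `0 < z < 1`, are limits, together with their images, of their
truncations, so they belong to the domain of the generator. -/
lemma IsLinearBirthDeathSemigroup.inGenerator_exp (hP : IsLinearBirthDeathSemigroup β P) {l : ℝ}
    (hl : 0 < l) :
    hP.isFeller.InGenerator (expC₀ (fun n : ℕ => (n : ℝ)) 0 l)
      (((1 - Real.exp (-l)) ^ 2 / Real.exp (-l)) • expC₀ (fun n : ℕ => (n : ℝ)) 1 l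
        - (β * (1 - Real.exp (-l))) • expC₀ (fun n : ℕ => (n : ℝ)) 0 l) := by
  have hX := isProperNonneg_nat
  set z : ℝ := Real.exp (-l) with hz
  have hz0 : 0 < z := Real.exp_pos _
  have hz1 : z < 1 := by rw [hz, Real.exp_lt_one_iff]; linarith
  -- the size of the image of a tail of `z ^ n`
  set b : ℕ → ℝ := fun n => (n + β) * z ^ n + n * z ^ (n - 1) with hb
  have hb0 : Tendsto b atTop (𝓝 0) := by
    have h0 : Tendsto (fun n : ℕ => z ^ n) atTop (𝓝 0) :=
      tendsto_pow_atTop_nhds_zero_of_lt_one hz0.le hz1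
    have h1 : Tendsto (fun n : ℕ => (n : ℝ) * z ^ n) atTop (𝓝 0) :=
      tendsto_self_mul_const_pow_of_lt_one hz0.le hz1
    have h2 : Tendsto (fun n : ℕ => (1 + z⁻¹) * ((n : ℝ) * z ^ n) + β * z ^ n) atTop (𝓝 0) := by
      simpa using (h1.const_mul (1 + z⁻¹)).add (h0.const_mul (β : ℝ))
    refine h2.congr fun n => ?_
    rcases n with _ | n
    · simp [hb]
    · simp only [hb, Nat.add_sub_cancel, pow_succ]
      field_simp
      ring
  refine IsFellerSemigroup.inGenerator_of_forall_exists fun η hη => ?_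
  obtain ⟨N, hN⟩ := eventually_atTop.1 ((hb0.eventually_le_const hη).and
    ((tendsto_pow_atTop_nhds_zero_of_lt_one hz0.le hz1).eventually_le_const hη))
  set f : ℕ → ℝ := fun n => if n < N + 1 then z ^ n else 0 with hf
  set r : ℕ → ℝ := fun n => if n < N + 1 then 0 else z ^ n with hr
  set A : (ℕ → ℝ) → ℕ → ℝ := fun f n => ((n : ℝ) + (β : ℝ)) * (f (n + 1) - f n)
    + (n : ℝ) * (f (n - 1) - f n) with hA
  have hfs : f.support.Finite := by
    refine (Finset.range (N + 1)).finite_toSet.subset fun n hn => ?_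
    by_contra h
    exact hn (if_neg (by simpa using h))
  have hAs : (A f).support.Finite := by
    refine (Finset.range (N + 2)).finite_toSet.subset fun n hn => ?_
    by_contra h
    have h : N + 2 ≤ n := by simpa using h
    refine hn ?_
    simp only [hA, hf]
    rw [if_neg (by lia), if_neg (by lia), if_neg (by lia)]
    simp
  have hcf : ⇑(ofFunC₀ f) = f :=
    coe_ofFunC₀ continuous_of_discreteTopology (tendsto_zero_cocompact_of_finite_support hfs)
  have hcg : ⇑(ofFunC₀ (A f)) = A f :=
    coe_ofFunC₀ continuous_of_discreteTopology (tendsto_zero_cocompact_of_finite_support hAs)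
  have hfr : ∀ n, f n = z ^ n - r n := fun n => by
    simp only [hf, hr]
    split_ifs <;> simp
  have hr0 : ∀ n, 0 ≤ r n := fun n => by
    simp only [hr]
    split_ifs <;> positivity
  have hrz : ∀ n, r n ≤ z ^ n := fun n => by
    simp only [hr]
    split_ifs
    · positivity
    · exact le_rfl
  have hrN : ∀ n, n ≤ N → r n = 0 := fun n hn => if_pos (by lia)
  refine ⟨_, _, IsFellerSemigroup.InGenerator.of_generatorMaps
    (f := ofFunC₀ f) (g := ofFunC₀ (A f))
    (by rw [hcf, hcg]; exact hP.generator f hfs), ?_, ?_⟩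
  · refine ZeroAtInftyContinuousMap.norm_le_of_forall hη.le fun n => ?_
    rw [ZeroAtInftyContinuousMap.coe_sub, Pi.sub_apply, hcf, coe_expC₀ hX _ hl, hfr]
    simp only [exp_neg_mul_natCast, ← hz, pow_zero, one_mul, sub_sub_cancel_left, abs_neg, abs_of_nonneg (hr0 n)]
    rcases le_total n N with h | h
    · rw [hrN n h]
      exact hη.le
    · exact (hrz n).trans (hN n h).2
  · refine ZeroAtInftyContinuousMap.norm_le_of_forall hη.le fun n => ?_
    have e1 : A (fun n => z ^ n) n
        = (((1 - z) ^ 2 / z) • expC₀ (fun n : ℕ => (n : ℝ)) 1 l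
        - (β * (1 - z)) • expC₀ (fun n : ℕ => (n : ℝ)) 0 l) n := by
      simp only [ZeroAtInftyContinuousMap.coe_sub, Pi.sub_apply, coe_expC₀ hX _ hl,
        ZeroAtInftyContinuousMap.coe_smul, Pi.smul_apply, smul_eq_mul, exp_neg_mul_natCast, ← hz,
        hA]
      rcases n with _ | n
      · simp
        ring
      · simp only [Nat.add_sub_cancel, pow_succ]
        field_simp
        ring
    have e2 : A f n - A (fun n => z ^ n) n = - A r n := by
      simp only [hA, hfr]
      ring
    rw [ZeroAtInftyContinuousMap.coe_sub, Pi.sub_apply, hcg, ← e1, e2, abs_neg]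
    rcases lt_or_ge n N with h | h
    · simp only [hA]
      rw [hrN _ (by lia), hrN _ (by lia), hrN _ (by lia)]
      simpa using hη.le
    · refine le_trans ?_ (hN n h).1
      refine (abs_add_le _ _).trans (add_le_add ?_ ?_)
      · rw [abs_mul, abs_of_nonneg (by positivity)]
        gcongr
        have h1 := hrz n
        have h2 := hrz (n + 1)
        have h3 : z ^ (n + 1) ≤ z ^ n := pow_le_pow_of_le_one hz0.le hz1.le (Nat.le_succ n)
        rw [abs_le]
        constructor <;> linarith [hr0 n, hr0 (n + 1)]
      · rw [abs_mul, abs_of_nonneg (by positivity)]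
        gcongr
        have h1 := hrz n
        have h2 := hrz (n - 1)
        have h3 : z ^ n ≤ z ^ (n - 1) := pow_le_pow_of_le_one hz0.le hz1.le (Nat.sub_le n 1)
        rw [abs_le]
        constructor <;> linarith [hr0 n, hr0 (n - 1)]

/-- The generating function of the birth-death kernels, from the same characteristic equations as
for the squared Bessel kernels, with `1 - z` in place of the Laplace variable. -/
lemma IsLinearBirthDeathSemigroup.integral_pow (hP : IsLinearBirthDeathSemigroup β P) (t : ℝ≥0)
    (n : ℕ) {z : ℝ} (hz0 : 0 < z) (hz1 : z < 1) :
    ∫ m, z ^ m ∂(P t n)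
      = (1 + (1 - z) * t) ^ (-(β : ℝ)) * (1 - (1 - z) / (1 + (1 - z) * t)) ^ n := by
  have hX := isProperNonneg_nat
  set w : ℝ := 1 - z with hw
  have hw0 : 0 < w := by linarith
  have h1 : ∀ s : ℝ, 0 ≤ s → 0 < 1 + w * s := fun s hs => by positivity
  have hq : ∀ s : ℝ, 0 ≤ s → 0 < 1 - w / (1 + w * s) := fun s hs => by
    rw [sub_pos, div_lt_one (h1 s hs)]
    nlinarith
  have hq1 : ∀ s : ℝ, 0 ≤ s → 1 - w / (1 + w * s) < 1 := fun s hs => by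
    linarith [div_pos hw0 (h1 s hs)]
  have hlog : ∀ s : ℝ, 0 ≤ s → 0 < -Real.log (1 - w / (1 + w * s)) := fun s hs =>
    neg_pos.2 (Real.log_neg (hq s hs) (hq1 s hs))
  have hexp : ∀ s : ℝ, 0 ≤ s → Real.exp (- -Real.log (1 - w / (1 + w * s)))
      = 1 - w / (1 + w * s) := fun s hs => by rw [neg_neg, Real.exp_log (hq s hs)]
  -- parametrize by `l = - log z`, so that `n ↦ z ^ n` is `expC₀ 0 l`
  have key := IsFellerSemigroup.act_eq_of_hasDerivAt (h := hP.isFeller)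
    (F := fun s => (1 + w * s) ^ (-(β : ℝ)) •
      expC₀ (fun n : ℕ => (n : ℝ)) 0 (-Real.log (1 - w / (1 + w * s))))
    (G := fun s => (1 + w * s) ^ (-(β : ℝ)) • (((w / (1 + w * s)) ^ 2 / (1 - w / (1 + w * s))) •
        expC₀ (fun n : ℕ => (n : ℝ)) 1 (-Real.log (1 - w / (1 + w * s)))
        - (β * (w / (1 + w * s))) •
          expC₀ (fun n : ℕ => (n : ℝ)) 0 (-Real.log (1 - w / (1 + w * s)))))
    (fun s hs => by
      have hd : HasDerivAt (fun s => -Real.log (1 - w / (1 + w * s)))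
          (-((w / (1 + w * s)) ^ 2 / (1 - w / (1 + w * s)))) s :=
        (((hasDerivAt_div_one_add_mul (h1 s hs)).const_sub 1).log (hq s hs).ne').neg.congr_deriv
          (by ring)
      refine ((hasDerivAt_one_add_mul_rpow β (h1 s hs)).smul
        ((hasDerivAt_expC₀ hX 0 (hlog s hs)).scomp s hd)).congr_deriv ?_
      ext y
      simp
      ring)
    (fun s hs => by
      have := hP.inGenerator_exp (hlog s hs)
      rw [hexp s hs, sub_sub_cancel] at this
      exact this.smul _) t
  have := congrArg (fun f : C₀(ℕ, ℝ) => f n) key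
  simp only [mul_zero, add_zero, Real.one_rpow, one_smul, div_one] at this
  rw [IsFellerSemigroup.act_apply] at this
  have h0 := hlog 0 le_rfl
  simp only [mul_zero, add_zero, div_one] at h0
  have h00 := hexp 0 le_rfl
  simp only [mul_zero, add_zero, div_one] at h00
  simp only [coe_expC₀ hX _ h0, coe_expC₀ hX _ (hlog t t.2), pow_zero, one_mul,
    exp_neg_mul_natCast, ZeroAtInftyContinuousMap.coe_smul, Pi.smul_apply, smul_eq_mul, h00,
    hexp t t.2] at this
  rw [← this]
  simp [hw]

end BirthDeath

/-! ### Uniqueness of Laplace transforms -/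

section Laplace

variable {E : Type*} [MeasurableSpace E] {X : E → ℝ}

lemma Iio_zero_subset_interior_integrableExpSet (μ : Measure E) [IsFiniteMeasure μ]
    (hX : Measurable X) (h0 : ∀ x, 0 ≤ X x) :
    Set.Iio 0 ⊆ interior (integrableExpSet X μ) := by
  refine interior_maximal (fun t ht => ?_) isOpen_Iio
  have ht : t < 0 := ht
  refine Integrable.of_bound (by fun_prop) 1 (ae_of_all _ fun x => ?_)
  rw [Real.norm_of_nonneg (Real.exp_pos _).le, Real.exp_le_one_iff]
  exact mul_nonpos_of_nonpos_of_nonneg ht.le (h0 x)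

/-- Two finite measures whose Laplace transforms agree on an interval have the same complex moment
generating function on the left half-plane, by analytic continuation. -/
lemma eqOn_complexMGF_of_laplace {μ μ' : Measure E} [IsFiniteMeasure μ] [IsFiniteMeasure μ']
    (hX : Measurable X) (h0 : ∀ x, 0 ≤ X x) {a b : ℝ} (ha : 0 ≤ a) (hab : a < b)
    (h : ∀ l ∈ Set.Ioo a b, ∫ x, Real.exp (-(l * X x)) ∂μ = ∫ x, Real.exp (-(l * X x)) ∂μ') :
    Set.EqOn (complexMGF X μ) (complexMGF X μ') {z | z.re < 0} := by
  have hsub : ∀ (μ : Measure E) [IsFiniteMeasure μ],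
      AnalyticOnNhd ℂ (complexMGF X μ) {z | z.re < 0} := fun μ _ =>
    analyticOnNhd_complexMGF.mono fun z hz => Iio_zero_subset_interior_integrableExpSet μ hX h0 hz
  have hconv : Convex ℝ {z : ℂ | z.re < 0} := convex_halfSpace_re_lt 0
  set m : ℝ := -((a + b) / 2) with hm
  refine (hsub μ).eqOn_of_preconnected_of_frequently_eq (hsub μ') hconv.isPreconnected
    (z₀ := (m : ℂ)) (by simp only [Set.mem_ofPred_eq, Complex.ofReal_re]; linarith) ?_
  have htend : Tendsto (fun x : ℝ => (x : ℂ)) (𝓝[≠] m) (𝓝[≠] (m : ℂ)) := by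
    refine tendsto_nhdsWithin_of_tendsto_nhds_of_eventually_within _
      (Complex.continuous_ofReal.tendsto m |>.mono_left nhdsWithin_le_nhds) ?_
    filter_upwards [self_mem_nhdsWithin] with x hx
    simpa using hx
  refine htend.frequently (Eventually.frequently ?_)
  filter_upwards [nhdsWithin_le_nhds (Ioo_mem_nhds (a := -b) (b := -a) (x := m)
    (by linarith) (by linarith))] with x hx
  have := h (-x) ⟨by linarith [hx.2], by linarith [hx.1]⟩
  simp only [neg_mul, neg_neg] at this
  rw [complexMGF_ofReal, complexMGF_ofReal, mgf, mgf, this]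

/-- A finite measure is determined by its Laplace transform on an interval: after exponential
tilting, the Laplace transform determines the characteristic function. -/
lemma measure_ext_of_laplace {μ μ' : Measure E} [IsFiniteMeasure μ] [IsFiniteMeasure μ']
    (hX : MeasurableEmbedding X) (h0 : ∀ x, 0 ≤ X x) {a b : ℝ} (ha : 0 ≤ a) (hab : a < b)
    (h : ∀ l ∈ Set.Ioo a b, ∫ x, Real.exp (-(l * X x)) ∂μ = ∫ x, Real.exp (-(l * X x)) ∂μ') :
    μ = μ' := by
  have hXm := hX.measurable
  have hEq := eqOn_complexMGF_of_laplace hXm h0 ha hab h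
  set d : E → ℝ≥0∞ := fun x => ENNReal.ofReal (Real.exp (-X x)) with hd
  have hdm : Measurable d := by fun_prop
  have hfin : ∀ (μ : Measure E) [IsFiniteMeasure μ], IsFiniteMeasure (μ.withDensity d) := by
    intro μ _
    refine isFiniteMeasure_withDensity (ne_of_lt ?_)
    calc ∫⁻ x, d x ∂μ ≤ ∫⁻ _, 1 ∂μ := by
          refine lintegral_mono fun x => ?_
          rw [hd, ← ENNReal.ofReal_one]
          exact ENNReal.ofReal_le_ofReal (by simpa using h0 x)
      _ < ⊤ := by simp
  have hchar : ∀ (μ : Measure E) [IsFiniteMeasure μ] (t : ℝ),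
      charFun ((μ.withDensity d).map X) t = complexMGF X μ (-1 + t * Complex.I) := by
    intro μ _ t
    rw [charFun_apply_real, hX.integral_map, integral_withDensity_eq_integral_toReal_smul hdm
      (ae_of_all _ fun x => ENNReal.ofReal_lt_top), complexMGF]
    refine integral_congr_ae (ae_of_all _ fun x => ?_)
    simp only [hd, ENNReal.toReal_ofReal (Real.exp_pos _).le, Complex.real_smul,
      Complex.ofReal_exp]
    rw [← Complex.exp_add]
    congr 1
    push_cast
    ring
  have := hfin μ
  have := hfin μ'
  have e1 : (μ.withDensity d).map X = (μ'.withDensity d).map X := by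
    refine Measure.ext_of_charFun (funext fun t => ?_)
    rw [hchar, hchar]
    exact hEq (by simp)
  have e2 : μ.withDensity d = μ'.withDensity d := by
    rw [← hX.comap_map (μ.withDensity d), e1, hX.comap_map]
  have hinv : ∀ μ : Measure E, (μ.withDensity d).withDensity (fun x => (d x)⁻¹) = μ := fun μ =>
    withDensity_inv_same hdm (ae_of_all _ fun x => by simp [hd, Real.exp_pos])
      (ae_of_all _ fun x => ENNReal.ofReal_ne_top)
  rw [← hinv μ, e2, hinv]

/-- An integrable function whose Laplace transform vanishes on an interval is zero: its positive and
negative parts are densities of finite measures with the same Laplace transform. -/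
lemma ae_eq_zero_of_laplace {μ : Measure E} {f : E → ℝ} (hf : Integrable f μ)
    (hX : MeasurableEmbedding X) (h0 : ∀ x, 0 ≤ X x) {a b : ℝ} (ha : 0 ≤ a) (hab : a < b)
    (h : ∀ l ∈ Set.Ioo a b, ∫ x, f x * Real.exp (-(l * X x)) ∂μ = 0) : f =ᵐ[μ] 0 := by
  have hint : ∀ {f : E → ℝ}, Integrable f μ → ∀ l ∈ Set.Ioo a b,
      Integrable (fun x => f x * Real.exp (-(l * X x))) μ := by
    intro f hf l hl
    have hXm := hX.measurable
    refine hf.mul_bdd (c := 1) (by fun_prop) (ae_of_all _ fun x => ?_)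
    rw [Real.norm_of_nonneg (Real.exp_pos _).le, Real.exp_le_one_iff]
    have := mul_nonneg (ha.trans hl.1.le) (h0 x)
    linarith
  have hfm : AEMeasurable (fun x => ENNReal.ofReal (f x)) μ := hf.1.aemeasurable.ennreal_ofReal
  have hfm' : AEMeasurable (fun x => ENNReal.ofReal (-f x)) μ :=
    hf.1.aemeasurable.neg.ennreal_ofReal
  have : IsFiniteMeasure (μ.withDensity fun x => ENNReal.ofReal (f x)) :=
    isFiniteMeasure_withDensity_ofReal hf.2
  have : IsFiniteMeasure (μ.withDensity fun x => ENNReal.ofReal (-f x)) :=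
    isFiniteMeasure_withDensity_ofReal hf.neg.2
  have key : μ.withDensity (fun x => ENNReal.ofReal (f x))
      = μ.withDensity fun x => ENNReal.ofReal (-f x) := by
    refine measure_ext_of_laplace hX h0 ha hab fun l hl => ?_
    rw [integral_withDensity_eq_integral_toReal_smul₀ hfm
      (ae_of_all _ fun x => ENNReal.ofReal_lt_top), integral_withDensity_eq_integral_toReal_smul₀
      hfm' (ae_of_all _ fun x => ENNReal.ofReal_lt_top), ← sub_eq_zero]
    simp only [ENNReal.toReal_ofReal', smul_eq_mul]
    rw [← integral_sub (hint hf.pos_part l hl) (hint hf.neg_part l hl)]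
    refine Eq.trans ?_ (h l hl)
    refine integral_congr_ae (ae_of_all _ fun x => ?_)
    simp only
    rw [← sub_mul, max_zero_sub_max_neg_zero_eq_self]
  have hfin : ∫⁻ x, ENNReal.ofReal (f x) ∂μ ≠ ⊤ := hf.lintegral_lt_top.ne
  filter_upwards [(withDensity_eq_iff hfm hfm' hfin).1 key] with x hx
  have h1 : max (f x) 0 = max (-f x) 0 := by
    rw [← ENNReal.toReal_ofReal', ← ENNReal.toReal_ofReal', hx]
  rw [Pi.zero_apply, ← max_zero_sub_max_neg_zero_eq_self (f x), h1, sub_self]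

end Laplace

section GeneratingFunction

lemma exp_neg_mem_Ioo {l : ℝ} (hl : 0 < l) : Real.exp (-l) ∈ Set.Ioo (0 : ℝ) 1 :=
  ⟨Real.exp_pos _, by rw [Real.exp_lt_one_iff]; linarith⟩

/-- A finite measure on `ℤ₊` is determined by its generating function on `(0, 1)`. -/
lemma measure_ext_of_integral_pow {μ μ' : Measure ℕ} [IsFiniteMeasure μ] [IsFiniteMeasure μ']
    (h : ∀ z ∈ Set.Ioo (0 : ℝ) 1, ∫ n, z ^ n ∂μ = ∫ n, z ^ n ∂μ') : μ = μ' := by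
  refine measure_ext_of_laplace (X := fun n : ℕ => (n : ℝ)) .natCast (fun n => n.cast_nonneg)
    le_rfl one_pos fun l hl => ?_
  simpa only [exp_neg_mul_natCast] using h _ (exp_neg_mem_Ioo hl.1)

lemma ae_eq_zero_of_integral_mul_pow {μ : Measure ℕ} {f : ℕ → ℝ} (hf : Integrable f μ)
    (h : ∀ z ∈ Set.Ioo (0 : ℝ) 1, ∫ n, f n * z ^ n ∂μ = 0) : f =ᵐ[μ] 0 := by
  refine ae_eq_zero_of_laplace (X := fun n : ℕ => (n : ℝ)) hf .natCast (fun n => n.cast_nonneg)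
    le_rfl one_pos fun l hl => ?_
  simpa only [exp_neg_mul_natCast] using h _ (exp_neg_mem_Ioo hl.1)

lemma measure_ext_of_integral_exp {μ μ' : Measure ℝ≥0} [IsFiniteMeasure μ] [IsFiniteMeasure μ']
    (h : ∀ l : ℝ, 0 < l → ∫ x, Real.exp (-(l * x)) ∂μ = ∫ x, Real.exp (-(l * x)) ∂μ') :
    μ = μ' :=
  measure_ext_of_laplace (X := fun x : ℝ≥0 => (x : ℝ))
    NNReal.isClosedEmbedding_coe.measurableEmbedding (fun x => x.2) le_rfl one_pos
    fun l hl => h l hl.1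

end GeneratingFunction

/-! ### The Poisson kernels and binomial thinning -/

section Poisson

/-- The kernel `x ↦ Pois(σ x)` from `ℝ₊` to `ℤ₊`, whose action on functions is `Λ_σ`. -/
noncomputable def poissonDilKernel (σ : ℝ≥0) : Kernel ℝ≥0 ℕ where
  toFun x := poissonMeasure (σ * x)
  measurable' := by
    refine Measure.measurable_of_measurable_coe _ fun s hs => ?_
    simp only [poissonMeasure, Measure.sum_apply _ hs, Measure.smul_apply, smul_eq_mul]
    fun_prop

lemma poissonDilKernel_apply (σ x : ℝ≥0) : poissonDilKernel σ x = poissonMeasure (σ * x) := rfl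

instance (σ : ℝ≥0) : IsMarkovKernel (poissonDilKernel σ) :=
  ⟨fun x => by rw [poissonDilKernel_apply]; infer_instance⟩

lemma integrable_pow_poissonMeasure (r : ℝ≥0) (z : ℝ) :
    Integrable (fun n => z ^ n) (poissonMeasure r) := by
  rw [integrable_poissonMeasure_iff]
  refine ((Real.summable_pow_div_factorial (r * |z|)).mul_left (Real.exp (-r))).congr fun n => ?_
  rw [Real.norm_eq_abs, abs_pow, mul_pow]
  ring

lemma integral_pow_poissonMeasure (r : ℝ≥0) (z : ℝ) :
    ∫ n, z ^ n ∂(poissonMeasure r) = Real.exp (-((1 - z) * r)) := by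
  rw [integral_poissonMeasure]
  have h := (NormedSpace.expSeries_div_hasSum_exp (r * z : ℝ)).mul_left (Real.exp (-r))
  rw [← Real.exp_eq_exp_ℝ, ← Real.exp_add] at h
  have e : -((1 - z) * r) = -r + r * z := by ring
  rw [e, ← h.tsum_eq]
  refine tsum_congr fun n => ?_
  rw [smul_eq_mul, mul_pow]
  ring

lemma integrable_of_abs_le {E : Type*} [MeasurableSpace E] {μ : Measure E} [IsFiniteMeasure μ]
    {f : E → ℝ} (hf : Measurable f) {C : ℝ} (hC : ∀ x, |f x| ≤ C) : Integrable f μ :=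
  .of_bound hf.aestronglyMeasurable C (ae_of_all _ hC)

lemma abs_integral_le {E : Type*} [MeasurableSpace E] (μ : Measure E) [IsProbabilityMeasure μ]
    {f : E → ℝ} {C : ℝ} (hC : ∀ x, |f x| ≤ C) : |∫ x, f x ∂μ| ≤ C := by
  simpa using norm_integral_le_of_norm_le_const (μ := μ) (f := f) (C := C) (ae_of_all _ hC)

lemma integrable_pow_nat {μ : Measure ℕ} [IsFiniteMeasure μ] {z : ℝ} (hz0 : 0 ≤ z) (hz1 : z ≤ 1) :
    Integrable (fun n => z ^ n) μ :=
  integrable_of_abs_le .of_discrete (C := 1) fun n => by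
    rw [abs_of_nonneg (by positivity)]
    exact pow_le_one₀ hz0 hz1

lemma poisson_weight_mul_discDil (v y : ℝ≥0) (g : ℕ → ℝ) (n : ℕ) :
    (y : ℝ) ^ n / n.factorial * discDil v g n = ∑ k ∈ Finset.range (n + 1),
      ((v * y : ℝ) ^ k / k.factorial * g k) *
        (((1 - v) * y : ℝ) ^ (n - k) / (n - k).factorial) := by
  rw [discDil, Finset.mul_sum]
  refine Finset.sum_congr rfl fun k hk => ?_
  have hkn : k ≤ n := Nat.lt_succ_iff.1 (Finset.mem_range.1 hk)
  rw [Nat.cast_choose ℝ hkn, mul_pow, mul_pow]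
  have : (y : ℝ) ^ n = y ^ k * y ^ (n - k) := by rw [← pow_add, Nat.add_sub_cancel' hkn]
  rw [this]
  field_simp

/-- Binomial thinning of a Poisson variable, `Λ 𝔻_v = d_v Λ`, also for `v > 1`: the Poisson series
of `𝔻_v g` is the Cauchy product of that of `g` and an exponential series. -/
lemma poisson_thinning {v y : ℝ≥0} {g : ℕ → ℝ} (hg : Integrable g (poissonMeasure (v * y))) :
    Integrable (discDil v g) (poissonMeasure y) ∧
      ∫ n, discDil v g n ∂(poissonMeasure y) = ∫ n, g n ∂(poissonMeasure (v * y)) := by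
  set a : ℕ → ℝ := fun k => (v * y : ℝ) ^ k / k.factorial * g k with ha
  set b : ℕ → ℝ := fun k => ((1 - v) * y : ℝ) ^ k / k.factorial with hb
  have hsa : Summable fun k => ‖a k‖ := by
    have h := (integrable_poissonMeasure_iff.1 hg).mul_left (Real.exp ((v * y : ℝ≥0) : ℝ))
    refine h.congr fun n => ?_
    simp only [ha, norm_mul, Real.norm_of_nonneg (show 0 ≤ (v * y : ℝ) ^ n / n.factorial by
      positivity), Real.exp_neg]
    push_cast
    field_simp
  have hsb : Summable fun k => ‖b k‖ := (Real.summable_pow_div_factorial _).norm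
  have hprod : ∀ n, (y : ℝ) ^ n / n.factorial * discDil v g n
      = ∑ k ∈ Finset.range (n + 1), a k * b (n - k) := poisson_weight_mul_discDil v y g
  refine ⟨?_, ?_⟩
  · rw [integrable_poissonMeasure_iff]
    refine ((summable_norm_sum_mul_range_of_summable_norm hsa hsb).mul_left
      (Real.exp (-y))).congr fun n => ?_
    rw [← hprod, norm_mul, Real.norm_of_nonneg (by positivity)]
    ring
  · rw [integral_poissonMeasure, integral_poissonMeasure]
    have h1 : ∀ n : ℕ, (Real.exp (-y) * (y : ℝ) ^ n / n.factorial) • discDil v g n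
        = Real.exp (-y) * ∑ k ∈ Finset.range (n + 1), a k * b (n - k) := fun n => by
      rw [← hprod, smul_eq_mul]
      ring
    have h2 : ∀ n : ℕ, (Real.exp (-(v * y : ℝ≥0)) * ((v * y : ℝ≥0) : ℝ) ^ n / n.factorial) • g n
        = Real.exp (-(v * y : ℝ≥0)) * a n := fun n => by
      simp only [ha, smul_eq_mul]
      push_cast
      ring
    have hbsum : ∑' k, b k = Real.exp ((1 - v) * y) := by
      rw [Real.exp_eq_exp_ℝ]
      exact (NormedSpace.expSeries_div_hasSum_exp _).tsum_eq
    simp only [h1, h2]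
    rw [tsum_mul_left, tsum_mul_left, ← tsum_mul_tsum_eq_tsum_sum_range_of_summable_norm hsa hsb,
      hbsum, mul_left_comm, ← Real.exp_add, mul_comm]
    congr 2
    push_cast
    ring

end Poisson

/-! ### Intertwining of the squared Bessel and the birth-death semigroups -/

section Intertwining

variable {β : ℝ≥0} {Q : ℝ≥0 → Kernel ℝ≥0 ℝ≥0} {P : ℝ≥0 → Kernel ℕ ℕ}

lemma IsSquaredBesselSemigroup.integral_exp_of_nonneg (hQ : IsSquaredBesselSemigroup β Q)
    (t x : ℝ≥0) {l : ℝ} (hl : 0 ≤ l) :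
    ∫ y, Real.exp (-(l * y)) ∂(Q t x)
      = (1 + l * t) ^ (-(β : ℝ)) * Real.exp (-(l / (1 + l * t) * x)) := by
  rcases hl.eq_or_lt with rfl | hl
  · have := hQ.isFeller.markov t
    simp
  · exact hQ.integral_exp t x hl

lemma integrable_exp_neg_nnreal {μ : Measure ℝ≥0} [IsFiniteMeasure μ] {l : ℝ} (hl : 0 ≤ l) :
    Integrable (fun x : ℝ≥0 => Real.exp (-(l * x))) μ :=
  integrable_of_abs_le (by fun_prop) (C := 1) fun x => by
    rw [abs_of_pos (Real.exp_pos _), Real.exp_le_one_iff, neg_nonpos]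
    positivity

/-- `Q_u Λ_σ = Λ_σ ℚ_{σu}` as kernels. Both sides send `n ↦ z ^ n` to an exponential. -/
lemma birthDeath_comp_poissonDilKernel (hQ : IsSquaredBesselSemigroup β Q)
    (hP : IsLinearBirthDeathSemigroup β P) (σ u : ℝ≥0) :
    P (σ * u) ∘ₖ poissonDilKernel σ = poissonDilKernel σ ∘ₖ Q u := by
  have := hQ.isFeller.markov u
  have := hP.isFeller.markov (σ * u)
  ext1 x
  refine measure_ext_of_integral_pow fun z hz => ?_
  rw [Kernel.integral_comp (integrable_pow_nat hz.1.le hz.2.le),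
    Kernel.integral_comp (integrable_pow_nat hz.1.le hz.2.le)]
  simp only [hP.integral_pow _ _ hz.1 hz.2, poissonDilKernel_apply, integral_const_mul,
    integral_pow_poissonMeasure]
  have hw : 0 ≤ 1 - z := by linarith [hz.2]
  have h := hQ.integral_exp_of_nonneg u x (l := (1 - z) * σ) (by positivity)
  push_cast
  simp only [← mul_assoc]
  rw [h]
  congr 2
  ring

/-- The intertwining with `𝕊_{(σu,v)} = ℚ_{σu} 𝔻_v`: thinning moves `d_v` to `𝔻_v` inside the
`Q_u`-integral, and integrability of `𝔻_v f` is what Fubini's theorem needs for the two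
factorizations of `Q_u Λ_σ = Λ_σ ℚ_{σu}`. -/
lemma contS_poissonDil_eq_of_integrable (hQ : IsSquaredBesselSemigroup β Q)
    (hP : IsLinearBirthDeathSemigroup β P) (σ u v : ℝ≥0) {f : ℕ → ℝ} {C : ℝ}
    (hf : ∀ n, |f n| ≤ C) (x : ℝ≥0)
    (hI : Integrable (discDil v f) ((poissonMeasure (σ * x)).bind (P (σ * u)))) :
    contS Q u v (poissonDil σ f) x = poissonDil σ (discS P (σ * u) v f) x := by
  have hI' : Integrable (discDil v f) ((P (σ * u) ∘ₖ poissonDilKernel σ) x) := hI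
  calc contS Q u v (poissonDil σ f) x
      = ∫ y, ∫ n, f n ∂(poissonMeasure (v * (σ * y))) ∂(Q u x) := by
        simp only [contS, kernelAct, dil, poissonDil, poissonAct, mul_left_comm]
    _ = ∫ y, ∫ n, discDil v f n ∂(poissonDilKernel σ y) ∂(Q u x) := by
        refine integral_congr_ae (ae_of_all _ fun y => ?_)
        exact (poisson_thinning (integrable_of_abs_le .of_discrete hf)).2.symm
    _ = ∫ k, discDil v f k ∂((P (σ * u) ∘ₖ poissonDilKernel σ) x) := by
        rw [birthDeath_comp_poissonDilKernel hQ hP] at hI' ⊢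
        rw [Kernel.integral_comp hI']
    _ = poissonDil σ (discS P (σ * u) v f) x := Kernel.integral_comp hI'

/-- The intertwining with `𝔻_v` on the left of the birth-death kernel. Thinning is applied last, to
the bounded function `ℚ_{vσu} f`, so no restriction on `(u, v)` is needed. -/
lemma contS_poissonDil_eq (hQ : IsSquaredBesselSemigroup β Q)
    (hP : IsLinearBirthDeathSemigroup β P) (σ u v : ℝ≥0) {f : ℕ → ℝ} {C : ℝ}
    (hf : ∀ n, |f n| ≤ C) (x : ℝ≥0) :
    Integrable (discDil v (kernelAct (P (v * (σ * u))) f)) (poissonMeasure (σ * x)) ∧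
      contS Q u v (poissonDil σ f) x =
        poissonDil σ (discDil v (kernelAct (P (v * (σ * u))) f)) x := by
  have := hQ.isFeller.markov u
  have := hP.isFeller.markov (v * (σ * u))
  have hb : ∀ n, |kernelAct (P (v * (σ * u))) f n| ≤ C := fun n => abs_integral_le _ hf
  obtain ⟨h1, h2⟩ := poisson_thinning (v := v) (y := σ * x)
    (integrable_of_abs_le (μ := poissonMeasure (v * (σ * x))) .of_discrete hb)
  refine ⟨h1, ?_⟩
  have hK := birthDeath_comp_poissonDilKernel hQ hP (v * σ) u
  have e1 : contS Q u v (poissonDil σ f) x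
      = ∫ y, ∫ n, f n ∂(poissonDilKernel (v * σ) y) ∂(Q u x) := by
    simp only [contS, kernelAct, dil, poissonDil, poissonAct, poissonDilKernel_apply, mul_left_comm,
      mul_assoc]
  have e2 : poissonDil σ (discDil v (kernelAct (P (v * (σ * u))) f)) x
      = ∫ n, ∫ k, f k ∂(P (v * σ * u) n) ∂(poissonDilKernel (v * σ) x) := by
    rw [poissonDilKernel_apply, mul_assoc, mul_assoc]
    exact h2
  rw [e1, e2, mul_assoc, ← Kernel.integral_comp (integrable_of_abs_le .of_discrete hf), ← hK,
    mul_assoc, Kernel.integral_comp (integrable_of_abs_le .of_discrete hf)]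

end Intertwining

/-! ### Negative binomial laws and exponential moments of the birth-death kernels -/

section NegativeBinomial

lemma negBinWeight_nonneg (β s : ℝ≥0) (n : ℕ) : 0 ≤ negBinWeight β s n := by
  unfold negBinWeight
  positivity

/-- The binomial series with exponent `-b`, in terms of rising factorials. -/
lemma hasSum_prod_range_mul_pow (b : ℝ) {x : ℝ} (hx : |x| < 1) :
    HasSum (fun n : ℕ => (∏ i ∈ Finset.range n, (b + i)) / n.factorial * x ^ n)
      ((1 - x) ^ (-b)) := by
  have h := (Real.one_div_one_sub_rpow_hasFPowerSeriesOnBall_zero b).hasSum (y := x)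
    (by simpa [enorm_eq_nnnorm, ← NNReal.coe_lt_coe] using hx)
  simp only [FormalMultilinearSeries.ofScalars_apply_eq, smul_eq_mul, zero_add] at h
  rw [Real.rpow_neg (by linarith [(abs_lt.1 hx).2]), ← one_div]
  refine h.congr_fun fun n => ?_
  congr 1
  have h1 := Ring.factorial_nsmul_multichoose_eq_ascPochhammer b n
  rw [Polynomial.ascPochhammer_smeval_eq_eval, Ring.multichoose_eq, nsmul_eq_mul] at h1
  have h2 : (ascPochhammer ℝ n).eval b = ∏ i ∈ Finset.range n, (b + i) := by
    clear h h1
    induction n with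
    | zero => simp
    | succ n ih => rw [ascPochhammer_succ_eval, ih, Finset.prod_range_succ]
  rw [← h2, ← h1]
  field_simp

lemma hasSum_negBinWeight_mul_pow (β s : ℝ≥0) {z : ℝ} (hz : |z| * s < 1 + s) :
    HasSum (fun n => negBinWeight β s n * z ^ n) ((1 + (1 - z) * s) ^ (-(β : ℝ))) := by
  have hs : (0 : ℝ) < 1 + s := by positivity
  have hx : |s / (1 + s) * z| < 1 := by
    rw [abs_mul, abs_of_nonneg (by positivity), div_mul_eq_mul_div, div_lt_one hs]
    linarith
  have h := (hasSum_prod_range_mul_pow β hx).mul_left ((1 + (s : ℝ)) ^ (-(β : ℝ)))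
  rw [← Real.mul_rpow hs.le (by linarith [(abs_lt.1 hx).2])] at h
  have e : (1 + s : ℝ) * (1 - s / (1 + s) * z) = 1 + (1 - z) * s := by
    field_simp
    ring
  rw [e] at h
  refine h.congr_fun fun n => ?_
  rw [negBinWeight, mul_pow]
  ring

instance (β s : ℝ≥0) : IsProbabilityMeasure (negBinInv β s) := by
  have h := hasSum_negBinWeight_mul_pow β s (z := 1) (by simp)
  simp only [one_pow, mul_one, sub_self, zero_mul, add_zero, Real.one_rpow] at h
  exact h.isProbabilityMeasure_sum_dirac (negBinWeight_nonneg β s)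

lemma integrable_pow_negBinInv (β s : ℝ≥0) {z : ℝ} (hz : |z| * s < 1 + s) :
    Integrable (fun n => z ^ n) (negBinInv β s) := by
  rw [negBinInv, integrable_sum_dirac_iff (by simp)]
  refine (hasSum_negBinWeight_mul_pow β s (z := |z|) (by rwa [abs_abs])).summable.congr fun n => ?_
  rw [ENNReal.toReal_ofReal (negBinWeight_nonneg β s n), norm_pow, Real.norm_eq_abs]

lemma integral_pow_negBinInv (β s : ℝ≥0) {z : ℝ} (hz : |z| * s < 1 + s) :
    ∫ n, z ^ n ∂(negBinInv β s) = (1 + (1 - z) * s) ^ (-(β : ℝ)) := by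
  rw [negBinInv, integral_sum_dirac (by simp), ← (hasSum_negBinWeight_mul_pow β s hz).tsum_eq]
  refine tsum_congr fun n => ?_
  rw [ENNReal.toReal_ofReal (negBinWeight_nonneg β s n), smul_eq_mul]

/-- The law at time `t` of the birth-death process started at `n`: a binomial number `m` of the
`n` initial individuals has descendants, and given `m` the population is `m` plus a negative
binomial variable of parameter `β + m`. -/
noncomputable def birthDeathLaw (β t : ℝ≥0) (n : ℕ) : Measure ℕ :=
  ∑ m ∈ Finset.range (n + 1),
    ENNReal.ofReal (n.choose m * (1 / (1 + t : ℝ)) ^ m * (t / (1 + t : ℝ)) ^ (n - m)) •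
      (negBinInv (β + m) t).map (· + m)

lemma integrable_pow_birthDeathLaw (β t : ℝ≥0) (n : ℕ) {z : ℝ} (hz : |z| * t < 1 + t) :
    Integrable (fun k => z ^ k) (birthDeathLaw β t n) := by
  rw [birthDeathLaw, integrable_finsetSum_measure]
  intro m _
  refine Integrable.smul_measure ?_ ENNReal.ofReal_ne_top
  rw [integrable_map_measure .of_discrete .of_discrete]
  simp only [Function.comp_def, pow_add]
  exact (integrable_pow_negBinInv _ t hz).mul_const _

lemma integral_pow_birthDeathLaw (β t : ℝ≥0) (n : ℕ) {z : ℝ} (hz : |z| * t < 1 + t) :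
    ∫ k, z ^ k ∂(birthDeathLaw β t n)
      = (1 + (1 - z) * t) ^ (-(β : ℝ)) * (1 - (1 - z) / (1 + (1 - z) * t)) ^ n := by
  have hD : 0 < 1 + (1 - z) * t := by nlinarith [le_abs_self z, t.coe_nonneg]
  have hint := integrable_pow_birthDeathLaw β t n hz
  rw [birthDeathLaw, integrable_finsetSum_measure] at hint
  rw [birthDeathLaw, integral_finsetSum_measure hint]
  have e : (1 - (1 - z) / (1 + (1 - z) * t))
      = 1 / (1 + t) * (z / (1 + (1 - z) * t)) + t / (1 + t) := by
    field_simp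
    ring
  rw [e, add_pow, Finset.mul_sum]
  refine Finset.sum_congr rfl fun m _ => ?_
  rw [integral_smul_measure, ENNReal.toReal_ofReal (by positivity),
    integral_map .of_discrete .of_discrete]
  simp only [pow_add, integral_mul_const, integral_pow_negBinInv _ t hz]
  have : (1 + (1 - z) * t) ^ (-((β + m : ℝ≥0) : ℝ))
      = (1 + (1 - z) * t) ^ (-(β : ℝ)) / (1 + (1 - z) * t) ^ m := by
    rw [NNReal.coe_add, neg_add, ← sub_eq_add_neg, Real.rpow_sub hD, NNReal.coe_natCast,
      Real.rpow_natCast]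
  rw [this, smul_eq_mul, mul_pow, div_pow z]
  ring

variable {β : ℝ≥0} {P : ℝ≥0 → Kernel ℕ ℕ}

lemma IsLinearBirthDeathSemigroup.eq_birthDeathLaw (hP : IsLinearBirthDeathSemigroup β P)
    (t : ℝ≥0) (n : ℕ) : P t n = birthDeathLaw β t n := by
  have := hP.isFeller.markov t
  have : IsFiniteMeasure (birthDeathLaw β t n) := by
    have h := integrable_pow_birthDeathLaw β t n (z := 1) (by simp)
    simp only [one_pow] at h
    exact (integrable_const_iff.1 h).resolve_left one_ne_zero
  refine measure_ext_of_integral_pow fun z hz => ?_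
  rw [hP.integral_pow t n hz.1 hz.2, integral_pow_birthDeathLaw]
  rw [abs_of_pos hz.1]
  nlinarith [t.coe_nonneg, hz.2]

lemma IsLinearBirthDeathSemigroup.integrable_pow (hP : IsLinearBirthDeathSemigroup β P)
    (t : ℝ≥0) (n : ℕ) {z : ℝ} (hz : |z| * t < 1 + t) : Integrable (fun k => z ^ k) (P t n) := by
  rw [hP.eq_birthDeathLaw]
  exact integrable_pow_birthDeathLaw β t n hz

/-- The generating function in the whole disc of convergence of the negative binomial series, of
radius `(1 + t) / t`. -/
lemma IsLinearBirthDeathSemigroup.integral_pow_of_lt (hP : IsLinearBirthDeathSemigroup β P)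
    (t : ℝ≥0) (n : ℕ) {z : ℝ} (hz : |z| * t < 1 + t) :
    ∫ k, z ^ k ∂(P t n)
      = (1 + (1 - z) * t) ^ (-(β : ℝ)) * (1 - (1 - z) / (1 + (1 - z) * t)) ^ n := by
  rw [hP.eq_birthDeathLaw]
  exact integral_pow_birthDeathLaw β t n hz

lemma abs_discDil_le (v : ℝ≥0) {f : ℕ → ℝ} {C : ℝ} (hf : ∀ n, |f n| ≤ C) (n : ℕ) :
    |discDil v f n| ≤ C * (v + |1 - (v : ℝ)|) ^ n := by
  rw [discDil, add_pow, Finset.mul_sum]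
  refine (Finset.abs_sum_le_sum_abs _ _).trans (Finset.sum_le_sum fun m _ => ?_)
  rw [abs_mul, abs_mul, abs_mul, abs_pow, abs_pow, abs_of_nonneg v.coe_nonneg, Nat.abs_cast]
  calc |f m| * (n.choose m * (v : ℝ) ^ m * |1 - (v : ℝ)| ^ (n - m))
      ≤ C * (n.choose m * (v : ℝ) ^ m * |1 - (v : ℝ)| ^ (n - m)) := by
        gcongr
        exact hf m
    _ = _ := by ring

lemma discDil_pow (v : ℝ≥0) (z : ℝ) (n : ℕ) :
    discDil v (fun m => z ^ m) n = (1 - v * (1 - z)) ^ n := by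
  have e : 1 - v * (1 - z) = v * z + (1 - v) := by ring
  rw [discDil, e, add_pow]
  refine Finset.sum_congr rfl fun m _ => ?_
  rw [mul_pow]
  ring

/-- The condition `2 s (v - 1) < 1` says that the growth rate `v + |1 - v|` of `𝔻_v` on bounded
functions is smaller than the radius of convergence `(1 + s) / s` of the generating function of the
birth-death kernel at time `s`. -/
lemma add_abs_one_sub_mul_lt {v s : ℝ≥0} (h : 2 * (s : ℝ) * ((v : ℝ) - 1) < 1) :
    abs ((v : ℝ) + |1 - (v : ℝ)|) * s < 1 + s := by
  rw [abs_of_nonneg (by positivity : (0 : ℝ) ≤ v + |1 - (v : ℝ)|)]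
  rcases abs_cases (1 - (v : ℝ)) with ⟨h1, _⟩ | ⟨h1, _⟩ <;> rw [h1] <;> nlinarith

lemma integrable_discDil_birthDeath (hP : IsLinearBirthDeathSemigroup β P) {v s : ℝ≥0}
    (h : 2 * (s : ℝ) * ((v : ℝ) - 1) < 1) {f : ℕ → ℝ} {C : ℝ} (hf : ∀ n, |f n| ≤ C) (n : ℕ) :
    Integrable (discDil v f) (P s n) :=
  ((hP.integrable_pow s n (add_abs_one_sub_mul_lt h)).const_mul C).mono' .of_discrete
    (ae_of_all _ fun k => abs_discDil_le v hf k)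

lemma integrable_discDil_poisson_bind (hP : IsLinearBirthDeathSemigroup β P) {v s : ℝ≥0}
    (h : 2 * (s : ℝ) * ((v : ℝ) - 1) < 1) {f : ℕ → ℝ} {C : ℝ} (hf : ∀ n, |f n| ≤ C) (r : ℝ≥0) :
    Integrable (discDil v f) ((poissonMeasure r).bind (P s)) := by
  have hR := add_abs_one_sub_mul_lt h
  suffices Integrable (fun k => ((v : ℝ) + |1 - (v : ℝ)|) ^ k) ((poissonMeasure r).bind (P s)) from
    (this.const_mul C).mono' .of_discrete (ae_of_all _ fun k => abs_discDil_le v hf k)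
  rw [Measure.integrable_comp_iff (κ := P s) (μ := poissonMeasure r)
    (f := fun k => ((v : ℝ) + |1 - (v : ℝ)|) ^ k) .of_discrete]
  refine ⟨ae_of_all _ fun n => hP.integrable_pow s n hR, ?_⟩
  have e : ∀ n : ℕ, ‖((v : ℝ) + |1 - (v : ℝ)|) ^ n‖ = ((v : ℝ) + |1 - (v : ℝ)|) ^ n := fun n =>
    Real.norm_of_nonneg (by positivity)
  simp only [e, hP.integral_pow_of_lt s _ hR]
  exact (integrable_pow_poissonMeasure _ _).const_mul _

end NegativeBinomial

/-! ### Commutation of `𝔻_v` with the birth-death semigroup -/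

section Commutation

variable {β : ℝ≥0} {P : ℝ≥0 → Kernel ℕ ℕ}

lemma eq_of_tsum_pow_mul_eq {a b : ℕ → ℝ} (ha : Summable a) (hb : Summable b)
    (h : ∀ z ∈ Set.Ioo (0 : ℝ) 1, ∑' m, z ^ m * a m = ∑' m, z ^ m * b m) : a = b := by
  have hsum : ∀ {a : ℕ → ℝ}, Summable a → ∀ z ∈ Set.Ioo (0 : ℝ) 1,
      Summable fun m => z ^ m * a m := fun ha z hz =>
    .of_norm_bounded ha.norm fun m => by
      rw [norm_mul]
      refine mul_le_of_le_one_left (norm_nonneg _) ?_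
      rw [Real.norm_of_nonneg (pow_nonneg hz.1.le m)]
      exact pow_le_one₀ hz.1.le hz.2.le
  have hc : Integrable (fun m => a m - b m) (Measure.count : Measure ℕ) :=
    integrable_count_iff.2 (ha.sub hb).norm
  have key := ae_eq_zero_of_integral_mul_pow hc fun z hz => by
    have h1 : (fun m => (a m - b m) * z ^ m) = fun m => z ^ m * a m - z ^ m * b m := by
      ext m
      ring
    have hs := (hsum ha z hz).sub (hsum hb z hz)
    rw [h1, integral_countable (integrable_count_iff.2 hs.norm)]
    simp only [Measure.real, Measure.count_singleton, ENNReal.toReal_one, one_smul]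
    rw [(hsum ha z hz).tsum_sub (hsum hb z hz), h z hz, sub_self]
  ext m
  have := Measure.ae_count_iff.1 key m
  exact sub_eq_zero.1 this

lemma hasSum_mul_real_singleton (μ : Measure ℕ) [IsFiniteMeasure μ] {f : ℕ → ℝ} {C : ℝ}
    (hf : ∀ n, |f n| ≤ C) :
    HasSum (fun m => f m * μ.real {m}) (∫ m, f m ∂μ) := by
  have hs : HasSum (fun m => μ.real {m} • f m) (∫ m, f m ∂μ) := by
    conv => arg 2; rw [← Measure.sum_smul_dirac μ]
    exact hasSum_integral_sum_dirac (by simp) (by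
      have := integrable_of_abs_le (μ := μ) .of_discrete hf
      rw [← Measure.sum_smul_dirac μ] at this
      exact (integrable_sum_dirac_iff (by simp)).1 this)
  simpa only [smul_eq_mul, mul_comm] using hs

/-- The coefficients of `𝔻_v`. -/
noncomputable def thinWeight (v : ℝ≥0) (n m : ℕ) : ℝ :=
  n.choose m * (v : ℝ) ^ m * (1 - (v : ℝ)) ^ (n - m)

lemma thinWeight_eq_zero (v : ℝ≥0) {n m : ℕ} (h : n < m) : thinWeight v n m = 0 := by
  rw [thinWeight, Nat.choose_eq_zero_of_lt h]
  simp

lemma discDil_eq_sum (v : ℝ≥0) (f : ℕ → ℝ) (n : ℕ) :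
    discDil v f n = ∑ m ∈ Finset.range (n + 1), f m * thinWeight v n m := rfl

lemma sum_abs_thinWeight_le (v : ℝ≥0) (n : ℕ) (s : Finset ℕ) :
    ∑ m ∈ s, |thinWeight v n m| ≤ ((v : ℝ) + |1 - (v : ℝ)|) ^ n := by
  calc ∑ m ∈ s, |thinWeight v n m| ≤ ∑ m ∈ Finset.range (n + 1), |thinWeight v n m| := by
        rw [Finset.sum_subset
          (Finset.subset_union_right : Finset.range (n + 1) ⊆ s ∪ Finset.range (n + 1)) fun m _ hm => by
          rw [Finset.mem_range] at hm
          rw [thinWeight_eq_zero v (by lia), abs_zero]]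
        exact Finset.sum_le_sum_of_subset_of_nonneg Finset.subset_union_left
          fun m _ _ => abs_nonneg _
    _ = ((v : ℝ) + |1 - (v : ℝ)|) ^ n := by
        rw [add_pow]
        refine Finset.sum_congr rfl fun m _ => ?_
        rw [thinWeight, abs_mul, abs_mul, abs_pow, abs_pow, abs_of_nonneg v.coe_nonneg,
          Nat.abs_cast]
        ring

/-- For a measure with a large enough exponential moment, `f ↦ ∫ 𝔻_v f ∂μ` is an absolutely
convergent series in the values of the bounded function `f`, although `𝔻_v` is not positive when
`v > 1`. -/
lemma exists_integral_discDil_eq_tsum (μ : Measure ℕ) (v : ℝ≥0)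
    (hμ : Integrable (fun n => ((v : ℝ) + |1 - (v : ℝ)|) ^ n) μ) :
    ∃ a : ℕ → ℝ, Summable a ∧ ∀ (f : ℕ → ℝ) (C : ℝ), (∀ n, |f n| ≤ C) →
      ∫ n, discDil v f n ∂μ = ∑' m, f m * a m := by
  have hw : ∀ m, Integrable (fun n => thinWeight v n m) μ := fun m =>
    hμ.mono' .of_discrete (ae_of_all _ fun n => by
      simpa using sum_abs_thinWeight_le v n {m})
  have hs : Summable fun m => ∫ n, |thinWeight v n m| ∂μ := by
    refine summable_of_sum_le (c := ∫ n, ((v : ℝ) + |1 - (v : ℝ)|) ^ n ∂μ)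
      (fun m => integral_nonneg fun n => abs_nonneg _) fun s => ?_
    rw [← integral_finsetSum _ fun m _ => (hw m).abs]
    exact integral_mono (integrable_finsetSum s fun m _ => (hw m).abs) hμ fun n =>
      sum_abs_thinWeight_le v n s
  refine ⟨fun m => ∫ n, thinWeight v n m ∂μ, .of_norm_bounded hs fun m =>
    norm_integral_le_integral_norm _, fun f C hf => ?_⟩
  have h1 : ∀ n, discDil v f n = ∑' m, f m * thinWeight v n m := fun n => by
    rw [discDil_eq_sum, tsum_eq_sum]
    intro m hm
    rw [thinWeight_eq_zero v (by rw [Finset.mem_range] at hm; lia), mul_zero]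
  simp only [h1]
  rw [← integral_tsum_of_summable_integral_norm (fun m => (hw m).const_mul (f m))]
  · simp only [integral_const_mul]
  · refine .of_nonneg_of_le (fun m => integral_nonneg fun n => norm_nonneg _) (fun m => ?_)
      (hs.mul_left C)
    simp only [norm_mul, integral_const_mul, Real.norm_eq_abs]
    exact mul_le_mul_of_nonneg_right (hf m) (integral_nonneg fun n => abs_nonneg _)

/-- `ℚ_s 𝔻_v = 𝔻_v ℚ_{vs}` on bounded functions. Both sides are absolutely convergent series in
the values of the function, and they agree on `n ↦ z ^ n`. -/
lemma discS_eq_discDil_kernelAct (hP : IsLinearBirthDeathSemigroup β P) {v s : ℝ≥0}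
    (h : 2 * (s : ℝ) * ((v : ℝ) - 1) < 1) {f : ℕ → ℝ} {C : ℝ} (hf : ∀ n, |f n| ≤ C) :
    discS P s v f = discDil v (kernelAct (P (v * s)) f) := by
  have := hP.isFeller.markov (v * s)
  ext n
  obtain ⟨a, ha, ha'⟩ := exists_integral_discDil_eq_tsum (P s n) v
    (hP.integrable_pow s n (add_abs_one_sub_mul_lt h))
  set b : ℕ → ℝ := fun m =>
    ∑ j ∈ Finset.range (n + 1), (P (v * s) j).real {m} * thinWeight v n j with hb
  have hbs : Summable b := by
    refine summable_sum fun j _ => Summable.mul_right _ ?_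
    simpa using (hasSum_mul_real_singleton (P (v * s) j) (f := fun _ => 1) (C := 1)
      (by simp)).summable
  have hb' : ∀ (f : ℕ → ℝ) (C : ℝ), (∀ n, |f n| ≤ C) →
      discDil v (kernelAct (P (v * s)) f) n = ∑' m, f m * b m := by
    intro f C hf
    have h1 := hasSum_sum (s := Finset.range (n + 1)) fun j _ =>
      (hasSum_mul_real_singleton (P (v * s) j) hf).mul_right (thinWeight v n j)
    rw [discDil_eq_sum]
    refine (h1.tsum_eq.symm.trans (tsum_congr fun m => ?_))
    rw [hb, Finset.mul_sum]
    exact Finset.sum_congr rfl fun j _ => by ring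
  have hab : a = b := by
    refine eq_of_tsum_pow_mul_eq ha hbs fun z hz => ?_
    have hz1 : ∀ n : ℕ, |z ^ n| ≤ 1 := fun n => by
      rw [abs_of_nonneg (pow_nonneg hz.1.le n)]
      exact pow_le_one₀ hz.1.le hz.2.le
    rw [← ha' _ 1 hz1, ← hb' _ 1 hz1]
    -- `1 - v (1 - z)` may be less than `-1`, but stays within the radius of convergence
    have hζ : |1 - v * (1 - z)| * s < 1 + s := by
      have h0 := hz.1
      have h1 := hz.2
      have h2 : (v : ℝ) * (1 - z) ≤ v := mul_le_of_le_one_right v.coe_nonneg (by linarith)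
      have h3 : 0 ≤ (v : ℝ) * (1 - z) := mul_nonneg v.coe_nonneg (by linarith)
      have h4 : (s : ℝ) * (v * (1 - z)) ≤ s * v := mul_le_mul_of_nonneg_left h2 s.coe_nonneg
      have h5 : 0 ≤ (s : ℝ) * (v * (1 - z)) := mul_nonneg s.coe_nonneg h3
      have hs := s.coe_nonneg
      rcases abs_cases (1 - v * (1 - z)) with ⟨h6, _⟩ | ⟨h6, _⟩ <;> rw [h6] <;> linarith
    simp only [discDil_pow]
    rw [hP.integral_pow_of_lt s n hζ]
    have e : kernelAct (P (v * s)) (fun m => z ^ m) = fun j =>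
        (1 + (1 - z) * (v * s : ℝ≥0)) ^ (-(β : ℝ)) *
          (1 - (1 - z) / (1 + (1 - z) * (v * s : ℝ≥0))) ^ j := by
      ext j
      exact hP.integral_pow _ _ hz.1 hz.2
    have e2 : ∀ (c : ℝ) (g : ℕ → ℝ), discDil v (fun j => c * g j) n = c * discDil v g n := by
      intro c g
      rw [discDil, discDil, Finset.mul_sum]
      exact Finset.sum_congr rfl fun j _ => by ring
    rw [e, e2, discDil_pow]
    push_cast
    congr 2
    · ring
    · rw [sub_sub_cancel, sub_sub_cancel]
      ring
  rw [discS, kernelAct, ha' f C hf, hab, hb' f C hf]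

end Commutation

/-! ### Markov kernels as contractions between `L²` spaces -/

section MarkovLp

variable {E F G : Type*} [MeasurableSpace E] [MeasurableSpace F] [MeasurableSpace G]
  {μ : Measure E} {μ' : Measure F} {μ'' : Measure G} {κ : Kernel E F} {η : Kernel F G}

lemma ae_ae_of_comp_eq (h : κ ∘ₘ μ = μ') {p : F → Prop} (hp : ∀ᵐ y ∂μ', p y) :
    ∀ᵐ x ∂μ, ∀ᵐ y ∂(κ x), p y := by
  subst h
  exact Measure.ae_ae_of_ae_comp hp

lemma ae_integrable_of_comp_eq (h : κ ∘ₘ μ = μ') {f : F → ℝ} (hf : Integrable f μ') :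
    ∀ᵐ x ∂μ, Integrable f (κ x) := by
  subst h
  exact Measure.ae_integrable_of_integrable_comp hf

lemma kernelAct_congr_ae (h : κ ∘ₘ μ = μ') {f g : F → ℝ} (hfg : f =ᵐ[μ'] g) :
    kernelAct κ f =ᵐ[μ] kernelAct κ g := by
  filter_upwards [ae_ae_of_comp_eq h hfg] with x hx using integral_congr_ae hx

/-- Jensen's inequality for a Markov kernel, in `L²`. -/
lemma eLpNorm_kernelAct_le [IsMarkovKernel κ] (h : κ ∘ₘ μ = μ') {f : F → ℝ}
    (hf : AEStronglyMeasurable f μ') :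
    eLpNorm (kernelAct κ f) 2 μ ≤ eLpNorm f 2 μ' := by
  subst h
  have h2 : ((2 : ℝ≥0) : ℝ≥0∞) = 2 := rfl
  have key : eLpNorm (kernelAct κ f) 2 μ ^ ((2 : ℝ≥0) : ℝ)
      ≤ eLpNorm f 2 (κ ∘ₘ μ) ^ ((2 : ℝ≥0) : ℝ) := by
    rw [← h2, eLpNorm_nnreal_pow_eq_lintegral two_ne_zero,
      eLpNorm_nnreal_pow_eq_lintegral two_ne_zero,
      Measure.lintegral_bind κ.aemeasurable (hf.enorm.pow_const _)]
    refine lintegral_mono_ae ?_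
    obtain ⟨g, hg, hfg⟩ := hf
    filter_upwards [Measure.ae_ae_of_ae_comp hfg] with x hx
    have hfx : AEStronglyMeasurable f (κ x) := ⟨g, hg, hx⟩
    rw [← eLpNorm_nnreal_pow_eq_lintegral two_ne_zero]
    refine ENNReal.rpow_le_rpow ?_ (by positivity)
    refine (enorm_integral_le_lintegral_enorm f).trans ?_
    rw [← eLpNorm_one_eq_lintegral_enorm]
    exact eLpNorm_le_eLpNorm_of_exponent_le (by rw [h2]; exact one_le_two) hfx
  exact (ENNReal.rpow_le_rpow_iff (by norm_num)).1 key

lemma memLp_kernelAct [IsMarkovKernel κ] (h : κ ∘ₘ μ = μ') {f : F → ℝ} (hf : MemLp f 2 μ') :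
    MemLp (kernelAct κ f) 2 μ := by
  refine ⟨?_, (eLpNorm_kernelAct_le h hf.1).trans_lt hf.2⟩
  subst h
  have hf' := hf.1
  rw [Measure.comp_eq_comp_const_apply] at hf'
  have h := hf'.integral_kernel_comp
  rw [Kernel.const_apply] at h
  exact h

/-- The contraction `L²(μ') → L²(μ)` induced by a Markov kernel `κ` with `μ κ = μ'`. -/
noncomputable def markovLp (κ : Kernel E F) [IsMarkovKernel κ] [IsProbabilityMeasure μ']
    (h : κ ∘ₘ μ = μ') : Lp ℝ 2 μ' →L[ℝ] Lp ℝ 2 μ :=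
  LinearMap.mkContinuous
    { toFun := fun g => (memLp_kernelAct h (Lp.memLp g)).toLp _
      map_add' := fun f g => by
        rw [← MemLp.toLp_add, MemLp.toLp_eq_toLp_iff]
        refine (kernelAct_congr_ae h (Lp.coeFn_add f g)).trans ?_
        filter_upwards [ae_integrable_of_comp_eq h ((Lp.memLp f).integrable one_le_two),
          ae_integrable_of_comp_eq h ((Lp.memLp g).integrable one_le_two)] with x hf hg
        exact integral_add hf hg
      map_smul' := fun c f => by
        rw [RingHom.id_apply, ← MemLp.toLp_const_smul, MemLp.toLp_eq_toLp_iff]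
        refine (kernelAct_congr_ae h (Lp.coeFn_smul c f)).trans (ae_of_all _ fun x => ?_)
        exact integral_const_mul c _ } 1 fun g => by
    rw [one_mul]
    simp only [LinearMap.coe_mk, AddHom.coe_mk, Lp.norm_toLp]
    rw [Lp.norm_def]
    exact ENNReal.toReal_mono (Lp.memLp g).2.ne (eLpNorm_kernelAct_le h (Lp.memLp g).1)

lemma ae_integrable_Lp_two [IsFiniteMeasure μ'] (h : κ ∘ₘ μ = μ') (g : Lp ℝ 2 μ') :
    ∀ᵐ x ∂μ, Integrable g (κ x) :=
  ae_integrable_of_comp_eq h ((Lp.memLp g).integrable one_le_two)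

variable [IsMarkovKernel κ] [IsMarkovKernel η] [IsProbabilityMeasure μ']
  [IsProbabilityMeasure μ'']

lemma coeFn_markovLp (h : κ ∘ₘ μ = μ') (g : Lp ℝ 2 μ') :
    markovLp κ h g =ᵐ[μ] kernelAct κ g :=
  MemLp.coeFn_toLp (memLp_kernelAct h (Lp.memLp g))

lemma markovLp_toLp (h : κ ∘ₘ μ = μ') {f : F → ℝ} (hf : MemLp f 2 μ') {g : E → ℝ}
    (hg : MemLp g 2 μ) (hfg : kernelAct κ f =ᵐ[μ] g) :
    markovLp κ h (hf.toLp f) = hg.toLp g := by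
  refine Lp.ext ?_
  refine (coeFn_markovLp h _).trans ((kernelAct_congr_ae h hf.coeFn_toLp).trans ?_)
  exact hfg.trans hg.coeFn_toLp.symm

lemma markovLp_markovLp (h : κ ∘ₘ μ = μ') (h' : η ∘ₘ μ' = μ'') (h'' : (η ∘ₖ κ) ∘ₘ μ = μ'')
    (g : Lp ℝ 2 μ'') : markovLp κ h (markovLp η h' g) = markovLp (η ∘ₖ κ) h'' g := by
  refine Lp.ext ?_
  refine (coeFn_markovLp h _).trans ((kernelAct_congr_ae h (coeFn_markovLp h' g)).trans ?_)
  refine EventuallyEq.trans ?_ (coeFn_markovLp h'' g).symm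
  filter_upwards [ae_integrable_Lp_two h'' g] with x hx
  exact (Kernel.integral_comp hx).symm

/-- `markovLp` depends only on the kernel, not on the way it is written. -/
lemma markovLp_congr {κ κ' : Kernel E F} [IsMarkovKernel κ] [IsMarkovKernel κ'] (e : κ = κ')
    (h : κ ∘ₘ μ = μ') (h' : κ' ∘ₘ μ = μ') : markovLp κ h = markovLp κ' h' := by
  subst e
  rfl

end MarkovLp

/-! ### The Laguerre kernels and their invariant laws -/

section LaguerreKernels

/-- The kernel on `ℤ₊` whose action is `𝔻_v`, for `v ≤ 1`: it sends `n` to the binomial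
distribution of parameters `n` and `v`. -/
noncomputable def thinKernel (v : ℝ≥0) : Kernel ℕ ℕ :=
  Kernel.ofFunOfCountable fun n =>
    Measure.sum fun m => ENNReal.ofReal (thinWeight v n m) • Measure.dirac m

lemma thinKernel_apply (v : ℝ≥0) (n : ℕ) : thinKernel v n =
    Measure.sum fun m => ENNReal.ofReal (thinWeight v n m) • Measure.dirac m := rfl

lemma thinWeight_nonneg {v : ℝ≥0} (hv : v ≤ 1) (n m : ℕ) : 0 ≤ thinWeight v n m := by
  have : (v : ℝ) ≤ 1 := hv
  have : 0 ≤ 1 - (v : ℝ) := by linarith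
  unfold thinWeight
  positivity

lemma hasSum_mul_thinWeight (v : ℝ≥0) (g : ℕ → ℝ) (n : ℕ) :
    HasSum (fun m => g m * thinWeight v n m) (discDil v g n) := by
  rw [discDil_eq_sum]
  refine hasSum_sum_of_ne_finset_zero fun m hm => ?_
  rw [thinWeight_eq_zero v (by rw [Finset.mem_range] at hm; lia), mul_zero]

lemma isMarkovKernel_thinKernel {v : ℝ≥0} (hv : v ≤ 1) : IsMarkovKernel (thinKernel v) := by
  refine ⟨fun n => ?_⟩
  have h := hasSum_mul_thinWeight v (fun _ => 1) n
  have e : discDil v (fun _ => 1) n = 1 := by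
    have := discDil_pow v 1 n
    simpa using this
  simp only [one_mul, e] at h
  exact h.isProbabilityMeasure_sum_dirac (thinWeight_nonneg hv n)

lemma integral_thinKernel {v : ℝ≥0} (hv : v ≤ 1) (g : ℕ → ℝ) (n : ℕ) :
    ∫ m, g m ∂(thinKernel v n) = discDil v g n := by
  rw [thinKernel_apply, integral_sum_dirac (by simp), ← (hasSum_mul_thinWeight v g n).tsum_eq]
  refine tsum_congr fun m => ?_
  rw [ENNReal.toReal_ofReal (thinWeight_nonneg hv n m), smul_eq_mul, mul_comm]

lemma thinKernel_comp_poissonDilKernel {v : ℝ≥0} (hv : v ≤ 1) (σ : ℝ≥0) :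
    thinKernel v ∘ₖ poissonDilKernel σ = poissonDilKernel (v * σ) := by
  have := isMarkovKernel_thinKernel hv
  ext1 x
  refine measure_ext_of_integral_pow fun z hz => ?_
  rw [Kernel.integral_comp (integrable_pow_nat hz.1.le hz.2.le)]
  simp only [integral_thinKernel hv]
  rw [poissonDilKernel_apply, poissonDilKernel_apply,
    (poisson_thinning (integrable_pow_poissonMeasure _ z)).2, mul_assoc]

lemma coe_lagV (t : ℝ≥0) : (lagV t : ℝ) = Real.exp (-t) :=
  Real.coe_toNNReal _ (Real.exp_pos _).le

lemma coe_lagU (ς t : ℝ≥0) : (lagU ς t : ℝ) = ς * (Real.exp t - 1) :=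
  Real.coe_toNNReal _ (mul_nonneg ς.coe_nonneg (by
    have := Real.one_le_exp t.coe_nonneg
    linarith))

lemma lagV_le_one (t : ℝ≥0) : lagV t ≤ 1 := by
  rw [← NNReal.coe_le_coe, coe_lagV, NNReal.coe_one, Real.exp_le_one_iff]
  exact neg_nonpos.2 t.coe_nonneg

lemma lagV_pos (t : ℝ≥0) : 0 < lagV t := by
  rw [← NNReal.coe_pos, coe_lagV]
  exact Real.exp_pos _

lemma lagU_mul (ς σ t : ℝ≥0) : lagU (ς * σ) t = σ * lagU ς t := by
  rw [← NNReal.coe_inj, NNReal.coe_mul, coe_lagU, coe_lagU]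
  push_cast
  ring

lemma lagV_mul_lagU_add (ς t : ℝ≥0) : (lagV t : ℝ) * (lagU ς t + ς) = ς := by
  have : Real.exp (-(t : ℝ)) * Real.exp t = 1 := by rw [← Real.exp_add]; simp
  rw [coe_lagV, coe_lagU]
  linear_combination (ς : ℝ) * this

/-- The kernel on `ℝ₊` whose action is `K_t`. -/
noncomputable def lagKernel (Q : ℝ≥0 → Kernel ℝ≥0 ℝ≥0) (ς t : ℝ≥0) : Kernel ℝ≥0 ℝ≥0 :=
  (Q (lagU ς t)).map (lagV t * ·)

/-- The kernel on `ℤ₊` whose action is `𝕂_t`. -/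
noncomputable def discLagKernel (P : ℝ≥0 → Kernel ℕ ℕ) (s t : ℝ≥0) : Kernel ℕ ℕ :=
  thinKernel (lagV t) ∘ₖ P (lagU s t)

variable {β : ℝ≥0} {Q : ℝ≥0 → Kernel ℝ≥0 ℝ≥0} {P : ℝ≥0 → Kernel ℕ ℕ}

lemma isMarkovKernel_lagKernel (hQ : IsSquaredBesselSemigroup β Q) (ς t : ℝ≥0) :
    IsMarkovKernel (lagKernel Q ς t) := by
  have := hQ.isFeller.markov (lagU ς t)
  exact Kernel.IsMarkovKernel.map _ (by fun_prop)

lemma isMarkovKernel_discLagKernel (hP : IsLinearBirthDeathSemigroup β P) (s t : ℝ≥0) :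
    IsMarkovKernel (discLagKernel P s t) := by
  have := hP.isFeller.markov (lagU s t)
  have := isMarkovKernel_thinKernel (lagV_le_one t)
  unfold discLagKernel
  infer_instance

lemma integral_lagKernel (ς t : ℝ≥0) {f : ℝ≥0 → ℝ} (hf : StronglyMeasurable f) (x : ℝ≥0) :
    ∫ y, f y ∂(lagKernel Q ς t x) = contK Q ς t f x := by
  rw [lagKernel, Kernel.map_apply _ (by fun_prop),
    integral_map (by fun_prop) hf.aestronglyMeasurable]
  rfl

lemma integrable_lagKernel_iff (ς t : ℝ≥0) {f : ℝ≥0 → ℝ} (hf : StronglyMeasurable f) (x : ℝ≥0) :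
    Integrable f (lagKernel Q ς t x) ↔ Integrable (dil (lagV t) f) (Q (lagU ς t) x) := by
  rw [lagKernel, Kernel.map_apply _ (by fun_prop),
    integrable_map_measure hf.aestronglyMeasurable (by fun_prop)]
  rfl

lemma integral_discLagKernel (s t : ℝ≥0) {g : ℕ → ℝ} {n : ℕ}
    (hg : Integrable g (discLagKernel P s t n)) :
    Integrable (discDil (lagV t) g) (P (lagU s t) n) ∧
      ∫ m, g m ∂(discLagKernel P s t n) = discK P s t g n := by
  have h := hg.integral_comp
  simp only [integral_thinKernel (lagV_le_one t)] at h
  refine ⟨h, ?_⟩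
  rw [discLagKernel, Kernel.integral_comp hg]
  simp only [integral_thinKernel (lagV_le_one t)]
  rfl

/-- `K_t Λ_σ = Λ_σ 𝕂_t` as kernels. -/
lemma discLagKernel_comp_poissonDilKernel (hQ : IsSquaredBesselSemigroup β Q)
    (hP : IsLinearBirthDeathSemigroup β P) (ς σ t : ℝ≥0) :
    discLagKernel P (ς * σ) t ∘ₖ poissonDilKernel σ
      = poissonDilKernel σ ∘ₖ lagKernel Q ς t := by
  rw [discLagKernel, Kernel.comp_assoc, lagU_mul, birthDeath_comp_poissonDilKernel hQ hP,
    ← Kernel.comp_assoc, thinKernel_comp_poissonDilKernel (lagV_le_one t), lagKernel,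
    Kernel.comp_map _ _ (by fun_prop)]
  congr 1
  ext1 x
  rw [Kernel.comap_apply, poissonDilKernel_apply, poissonDilKernel_apply]
  congr 1
  ring

lemma integral_exp_gammaMeasure {b ς : ℝ} (hb : 0 < b) (hς : 0 < ς) {l : ℝ} (hl : 0 ≤ l) :
    ∫ x, Real.exp (-(l * x.toNNReal)) ∂(gammaMeasure b ς⁻¹) = (1 + ς * l) ^ (-b) := by
  have hm : Measurable (gammaPDF b ς⁻¹) := (measurable_gammaPDFReal _ _).ennreal_ofReal
  rw [gammaMeasure, integral_withDensity_eq_integral_toReal_smul hm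
    (ae_of_all _ fun x => ENNReal.ofReal_lt_top)]
  have h0 : ∀ x : ℝ, x ∉ Set.Ici 0 →
      (gammaPDF b ς⁻¹ x).toReal • Real.exp (-(l * x.toNNReal)) = 0 := by
    intro x hx
    rw [gammaPDF_of_neg (by simpa using hx)]
    simp
  rw [← setIntegral_eq_integral_of_forall_compl_eq_zero h0, integral_Ici_eq_integral_Ioi]
  have h1 : ∀ x ∈ Set.Ioi (0 : ℝ), (gammaPDF b ς⁻¹ x).toReal • Real.exp (-(l * x.toNNReal))
      = ς⁻¹ ^ b / Real.Gamma b * (x ^ (b - 1) * Real.exp (-((ς⁻¹ + l) * x))) := by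
    intro x hx
    have hx : 0 < x := hx
    have e : Real.exp (-((ς⁻¹ + l) * x)) = Real.exp (-(ς⁻¹ * x)) * Real.exp (-(l * x)) := by
      rw [← Real.exp_add]
      congr 1
      ring
    have hG := Real.Gamma_pos_of_pos hb
    rw [gammaPDF_of_nonneg hx.le, ENNReal.toReal_ofReal (by positivity),
      Real.coe_toNNReal _ hx.le, smul_eq_mul, e]
    ring
  rw [setIntegral_congr_fun measurableSet_Ioi h1, integral_const_mul,
    Real.integral_rpow_mul_exp_neg_mul_Ioi hb (by positivity)]
  have hG := (Real.Gamma_pos_of_pos hb).ne'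
  rw [Real.rpow_neg (by positivity), ← Real.inv_rpow (by positivity)]
  have e : (1 + ς * l)⁻¹ = ς⁻¹ * (1 / (ς⁻¹ + l)) := by
    field_simp
  rw [e, Real.mul_rpow (by positivity) (by positivity)]
  field_simp

instance (β ς : ℝ≥0) : IsProbabilityMeasure (gammaInv β ς) := by
  unfold gammaInv
  split_ifs with h
  · have := isProbabilityMeasure_gammaMeasure (a := β) (r := (ς : ℝ)⁻¹) h.1 (by
      have := h.2
      positivity)
    exact Measure.isProbabilityMeasure_map (by fun_prop)
  · infer_instance

lemma integral_exp_gammaInv (β ς : ℝ≥0) {l : ℝ} (hl : 0 ≤ l) :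
    ∫ x, Real.exp (-(l * x)) ∂(gammaInv β ς) = (1 + ς * l) ^ (-(β : ℝ)) := by
  unfold gammaInv
  split_ifs with h
  · rw [integral_map (by fun_prop) (by fun_prop)]
    exact integral_exp_gammaMeasure h.1 h.2 hl
  · rw [integral_dirac]
    rcases not_and_or.1 h with h | h
    · simp [nonpos_iff_eq_zero.1 (not_lt.1 h)]
    · simp [nonpos_iff_eq_zero.1 (not_lt.1 h)]

/-- A negative binomial law is a gamma mixture of Poisson laws. -/
lemma poissonDilKernel_comp_gammaInv (β ς σ : ℝ≥0) :
    poissonDilKernel σ ∘ₘ gammaInv β ς = negBinInv β (ς * σ) := by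
  refine measure_ext_of_integral_pow fun z hz => ?_
  have hw : 0 ≤ 1 - z := by linarith [hz.2]
  have hint : Integrable (fun n => z ^ n) (poissonDilKernel σ ∘ₘ gammaInv β ς) :=
    integrable_pow_nat hz.1.le hz.2.le
  rw [Measure.comp_eq_comp_const_apply] at hint ⊢
  rw [Kernel.integral_comp hint, Kernel.const_apply]
  simp only [poissonDilKernel_apply, integral_pow_poissonMeasure, NNReal.coe_mul, ← mul_assoc]
  rw [integral_exp_gammaInv β ς (by positivity), integral_pow_negBinInv]
  · congr 1
    push_cast
    ring
  · rw [abs_of_pos hz.1]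
    nlinarith [(ς * σ).coe_nonneg, hz.2]

lemma integral_exp_lagKernel (hQ : IsSquaredBesselSemigroup β Q) (ς t x : ℝ≥0) {l : ℝ}
    (hl : 0 ≤ l) :
    ∫ y, Real.exp (-(l * y)) ∂(lagKernel Q ς t x)
      = (1 + l * lagV t * lagU ς t) ^ (-(β : ℝ)) *
        Real.exp (-(l * lagV t / (1 + l * lagV t * lagU ς t) * x)) := by
  rw [integral_lagKernel ς t (by fun_prop), contK, contS, kernelAct,
    ← hQ.integral_exp_of_nonneg _ _ (mul_nonneg hl (lagV t).coe_nonneg)]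
  simp only [dil, NNReal.coe_mul, mul_assoc]

lemma integral_pow_discLagKernel (hP : IsLinearBirthDeathSemigroup β P) (s t : ℝ≥0) (n : ℕ)
    {z : ℝ} (hz : z ∈ Set.Ioo (0 : ℝ) 1) :
    ∫ m, z ^ m ∂(discLagKernel P s t n)
      = (1 + lagV t * (1 - z) * lagU s t) ^ (-(β : ℝ)) *
        (1 - lagV t * (1 - z) / (1 + lagV t * (1 - z) * lagU s t)) ^ n := by
  have := isMarkovKernel_discLagKernel hP s t
  have hv : (lagV t : ℝ) ≤ 1 := lagV_le_one t
  have hv0 : (0 : ℝ) < lagV t := lagV_pos t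
  have hw : 0 < 1 - z := by linarith [hz.2]
  have h1 : 0 < lagV t * (1 - z) := by positivity
  rw [(integral_discLagKernel s t (integrable_pow_nat hz.1.le hz.2.le)).2, discK, discS,
    kernelAct]
  simp only [discDil_pow]
  rw [hP.integral_pow _ _ (z := 1 - lagV t * (1 - z)) (by nlinarith [hz.1]) (by linarith),
    sub_sub_cancel]

lemma lagKernel_comp_gammaInv (hQ : IsSquaredBesselSemigroup β Q) (ς t : ℝ≥0) :
    lagKernel Q ς t ∘ₘ gammaInv β ς = gammaInv β ς := by
  have := isMarkovKernel_lagKernel hQ ς t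
  refine measure_ext_of_integral_exp fun l hl => ?_
  have hint : Integrable (fun x : ℝ≥0 => Real.exp (-(l * x)))
      (lagKernel Q ς t ∘ₘ gammaInv β ς) := integrable_exp_neg_nnreal hl.le
  rw [Measure.comp_eq_comp_const_apply] at hint ⊢
  rw [Kernel.integral_comp hint, Kernel.const_apply]
  simp only [integral_exp_lagKernel hQ ς t _ hl.le, integral_const_mul]
  rw [integral_exp_gammaInv β ς (by positivity), integral_exp_gammaInv β ς hl.le,
    ← Real.mul_rpow (by positivity) (by positivity)]
  congr 1
  have h := lagV_mul_lagU_add ς t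
  field_simp
  linear_combination l * h

/-- The image of an invariant law under an intertwining kernel is invariant for the intertwined
semigroup. -/
lemma discLagKernel_comp_negBinInv (hQ : IsSquaredBesselSemigroup β Q)
    (hP : IsLinearBirthDeathSemigroup β P) (ς σ t : ℝ≥0) :
    discLagKernel P (ς * σ) t ∘ₘ negBinInv β (ς * σ) = negBinInv β (ς * σ) := by
  rw [← poissonDilKernel_comp_gammaInv, Measure.comp_assoc,
    discLagKernel_comp_poissonDilKernel hQ hP, ← Measure.comp_assoc, lagKernel_comp_gammaInv hQ]

end LaguerreKernels

/-! ### Unitary equivalence from families with the same Gram matrix -/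

section Unitary

/-- Two total families with the same Gram matrix are exchanged by a unitary operator. -/
lemma exists_linearIsometryEquiv_of_inner_eq {ι H₁ H₂ : Type*} [NormedAddCommGroup H₁]
    [InnerProductSpace ℝ H₁] [CompleteSpace H₁] [NormedAddCommGroup H₂] [InnerProductSpace ℝ H₂]
    [CompleteSpace H₂] {ψ : ι → H₁} {φ : ι → H₂}
    (hG : ∀ i j, inner ℝ (ψ i) (ψ j) = inner ℝ (φ i) (φ j))
    (hψ : Dense (Submodule.span ℝ (Set.range ψ) : Set H₁))
    (hφ : Dense (Submodule.span ℝ (Set.range φ) : Set H₂)) :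
    ∃ U : H₁ ≃ₗᵢ[ℝ] H₂, ∀ i, U (ψ i) = φ i := by
  have hd₁ : DenseRange (Finsupp.linearCombination ℝ ψ) := by
    rw [DenseRange, ← LinearMap.coe_range, Finsupp.range_linearCombination]
    exact hψ
  have hd₂ : DenseRange (Finsupp.linearCombination ℝ φ) := by
    rw [DenseRange, ← LinearMap.coe_range, Finsupp.range_linearCombination]
    exact hφ
  have hnorm : ∀ c : ι →₀ ℝ, ‖Finsupp.linearCombination ℝ φ (LinearEquiv.refl ℝ (ι →₀ ℝ) c)‖
      = ‖Finsupp.linearCombination ℝ ψ c‖ := by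
    intro c
    rw [LinearEquiv.refl_apply, ← sq_eq_sq₀ (norm_nonneg _) (norm_nonneg _),
      ← real_inner_self_eq_norm_sq, ← real_inner_self_eq_norm_sq, Finsupp.linearCombination_apply,
      Finsupp.linearCombination_apply, Finsupp.sum_inner, Finsupp.sum_inner]
    refine Finset.sum_congr rfl fun i _ => ?_
    simp only [Finsupp.inner_sum, real_inner_smul_left, real_inner_smul_right, hG]
  refine ⟨(LinearEquiv.refl ℝ (ι →₀ ℝ)).extendOfIsometry _ _ hd₁ hd₂ hnorm, fun i => ?_⟩
  have := (LinearEquiv.refl ℝ (ι →₀ ℝ)).extendOfIsometry_eq _ _ hd₁ hd₂ hnorm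
    (Finsupp.single i 1)
  simpa using this

lemma dense_span_of_forall_inner_eq_zero {ι H : Type*} [NormedAddCommGroup H]
    [InnerProductSpace ℝ H] [CompleteSpace H] {ψ : ι → H}
    (h : ∀ f : H, (∀ i, inner ℝ (ψ i) f = 0) → f = 0) :
    Dense (Submodule.span ℝ (Set.range ψ) : Set H) := by
  rw [Submodule.dense_iff_topologicalClosure_eq_top, Submodule.topologicalClosure_eq_top_iff,
    Submodule.eq_bot_iff]
  intro f hf
  refine h f fun i => ?_
  exact (Submodule.mem_orthogonal _ _).1 hf _ (Submodule.subset_span ⟨i, rfl⟩)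

lemma inner_toLp_eq_integral {E : Type*} [MeasurableSpace E] {μ : Measure E} {f : E → ℝ}
    (hf : MemLp f 2 μ) (g : Lp ℝ 2 μ) : inner ℝ (hf.toLp f) g = ∫ x, g x * f x ∂μ := by
  rw [L2.inner_def]
  refine integral_congr_ae ?_
  filter_upwards [hf.coeFn_toLp] with x hx
  rw [hx]
  rfl

/-- Two families of Markov operators that permute in the same way two total families of functions
with the same Gram matrix are unitarily equivalent. -/
lemma exists_unitary_markovLp {ι T E F : Type*} [MeasurableSpace E] [MeasurableSpace F]
    {μ : Measure E} [IsProbabilityMeasure μ] {ν : Measure F} [IsProbabilityMeasure ν]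
    {κ : T → Kernel E E} [∀ t, IsMarkovKernel (κ t)] {η : T → Kernel F F}
    [∀ t, IsMarkovKernel (η t)] (hκ : ∀ t, κ t ∘ₘ μ = μ) (hη : ∀ t, η t ∘ₘ ν = ν)
    {ψ : ι → E → ℝ} {φ : ι → F → ℝ} (hψ : ∀ i, MemLp (ψ i) 2 μ) (hφ : ∀ i, MemLp (φ i) 2 ν)
    (hG : ∀ i j, ∫ x, ψ i x * ψ j x ∂μ = ∫ x, φ i x * φ j x ∂ν)
    (hψt : ∀ f : E → ℝ, Integrable f μ → (∀ i, ∫ x, f x * ψ i x ∂μ = 0) → f =ᵐ[μ] 0)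
    (hφt : ∀ f : F → ℝ, Integrable f ν → (∀ i, ∫ x, f x * φ i x ∂ν = 0) → f =ᵐ[ν] 0)
    (τ : T → ι → ι) (hτψ : ∀ t i x, ∫ y, ψ i y ∂(κ t x) = ψ (τ t i) x)
    (hτφ : ∀ t i x, ∫ y, φ i y ∂(η t x) = φ (τ t i) x) :
    ∃ U : Lp ℝ 2 μ ≃ₗᵢ[ℝ] Lp ℝ 2 ν,
      ∀ t f, U (markovLp (κ t) (hκ t) f) = markovLp (η t) (hη t) (U f) := by
  have hd₁ : Dense (Submodule.span ℝ (Set.range fun i => (hψ i).toLp (ψ i)) : Set (Lp ℝ 2 μ)) := by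
    refine dense_span_of_forall_inner_eq_zero fun f hf => ?_
    rw [Lp.eq_zero_iff_ae_eq_zero]
    refine hψt f ((Lp.memLp f).integrable one_le_two) fun i => ?_
    rw [← inner_toLp_eq_integral (hψ i), hf i]
  have hd₂ : Dense (Submodule.span ℝ (Set.range fun i => (hφ i).toLp (φ i)) : Set (Lp ℝ 2 ν)) := by
    refine dense_span_of_forall_inner_eq_zero fun f hf => ?_
    rw [Lp.eq_zero_iff_ae_eq_zero]
    refine hφt f ((Lp.memLp f).integrable one_le_two) fun i => ?_
    rw [← inner_toLp_eq_integral (hφ i), hf i]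
  obtain ⟨U, hU⟩ := exists_linearIsometryEquiv_of_inner_eq
    (ψ := fun i => (hψ i).toLp (ψ i)) (φ := fun i => (hφ i).toLp (φ i)) (fun i j => by
      have h1 : ∫ x, ((hψ j).toLp (ψ j)) x * ψ i x ∂μ = ∫ x, ψ j x * ψ i x ∂μ :=
        integral_congr_ae ((hψ j).coeFn_toLp.mul (EventuallyEq.refl _ (ψ i)))
      have h2 : ∫ x, ((hφ j).toLp (φ j)) x * φ i x ∂ν = ∫ x, φ j x * φ i x ∂ν :=
        integral_congr_ae ((hφ j).coeFn_toLp.mul (EventuallyEq.refl _ (φ i)))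
      rw [inner_toLp_eq_integral, inner_toLp_eq_integral, h1, h2, hG]) hd₁ hd₂
  refine ⟨U, fun t f => ?_⟩
  have key : (U : Lp ℝ 2 μ →L[ℝ] Lp ℝ 2 ν) ∘L markovLp (κ t) (hκ t)
      = markovLp (η t) (hη t) ∘L (U : Lp ℝ 2 μ →L[ℝ] Lp ℝ 2 ν) := by
    refine ContinuousLinearMap.ext_on hd₁ ?_
    rintro _ ⟨i, rfl⟩
    have h1 := markovLp_toLp (hκ t) (hψ i) (hψ (τ t i)) (ae_of_all _ (hτψ t i))
    have h2 := markovLp_toLp (hη t) (hφ i) (hφ (τ t i)) (ae_of_all _ (hτφ t i))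
    change U (markovLp (κ t) (hκ t) ((hψ i).toLp (ψ i)))
      = markovLp (η t) (hη t) (U ((hψ i).toLp (ψ i)))
    rw [hU i, h1, h2, hU]
  exact DFunLike.congr_fun key f

end Unitary

/-! ### Unitary equivalence of the Laguerre semigroups -/

section LaguerreUnitary

variable {β : ℝ≥0} {Q : ℝ≥0 → Kernel ℝ≥0 ℝ≥0} {P : ℝ≥0 → Kernel ℕ ℕ}

/-- Used with `c` the scale parameter, `v = e ^ (-t)` and `u = c (e ^ t - 1)`; with the next identity
it shows that in the coordinate `r`, where the Laplace variable is `r / (c (1 - r))`, the semigroups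
act by `r ↦ v r`. -/
lemma one_add_mul_mul_of_eq {r c v u : ℝ} (hc : c ≠ 0) (hr : 1 - r ≠ 0) (h : v * (u + c) = c) :
    1 + r / (c * (1 - r)) * v * u = (1 - v * r) / (1 - r) := by
  field_simp
  linear_combination r * h

lemma mul_div_one_add_of_eq {r c v u : ℝ} (hc : c ≠ 0) (hr : 1 - r ≠ 0)
    (h : v * (u + c) = c) :
    r / (c * (1 - r)) * v / (1 + r / (c * (1 - r)) * v * u) = v * r / (c * (1 - v * r)) := by
  rw [one_add_mul_mul_of_eq hc hr h]
  field_simp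

/-- The function `(1 - r) ^ (-β) exp (- r x / (ς (1 - r)))`, the generating function in `r` of
Laguerre polynomials in `x / ς`. -/
noncomputable def laguerreGen (β ς : ℝ≥0) (r : ℝ) (x : ℝ≥0) : ℝ :=
  (1 - r) ^ (-(β : ℝ)) * Real.exp (-(r / (ς * (1 - r)) * x))

/-- The function `(1 - r) ^ (-β) (1 - r / (s (1 - r))) ^ n`, the generating function in `r` of
Meixner polynomials in `n`. -/
noncomputable def meixnerGen (β s : ℝ≥0) (r : ℝ) (n : ℕ) : ℝ :=
  (1 - r) ^ (-(β : ℝ)) * (1 - r / (s * (1 - r))) ^ n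

lemma meixner_base_mem_Ioo {s : ℝ≥0} (hs : 0 < s) {r : ℝ} (hr0 : 0 < r)
    (hr1 : r < s / (1 + s)) : 1 - r / (s * (1 - r)) ∈ Set.Ioo (0 : ℝ) 1 := by
  have hs : (0 : ℝ) < s := hs
  rw [lt_div_iff₀ (by positivity)] at hr1
  have h1 : 0 < 1 - r := by nlinarith
  constructor
  · rw [sub_pos, div_lt_one (by positivity)]
    linarith
  · have : 0 < r / (s * (1 - r)) := by positivity
    linarith

lemma integral_laguerreGen (hQ : IsSquaredBesselSemigroup β Q) {ς : ℝ≥0} (hς : 0 < ς) (t : ℝ≥0)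
    {r : ℝ} (hr0 : 0 ≤ r) (hr1 : r < 1) (x : ℝ≥0) :
    ∫ y, laguerreGen β ς r y ∂(lagKernel Q ς t x) = laguerreGen β ς (lagV t * r) x := by
  have hς : (0 : ℝ) < ς := hς
  have hv : (lagV t : ℝ) ≤ 1 := lagV_le_one t
  have hvr : 0 < 1 - lagV t * r := by nlinarith [(lagV t).coe_nonneg]
  have h1 : 0 < 1 - r := by linarith
  simp only [laguerreGen, integral_const_mul]
  rw [integral_exp_lagKernel hQ ς t x (by positivity),
    mul_div_one_add_of_eq hς.ne' h1.ne' (lagV_mul_lagU_add ς t),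
    one_add_mul_mul_of_eq hς.ne' h1.ne' (lagV_mul_lagU_add ς t), ← mul_assoc,
    ← Real.mul_rpow h1.le (by positivity), mul_div_cancel₀ _ h1.ne']

lemma integral_meixnerGen (hP : IsLinearBirthDeathSemigroup β P) {s : ℝ≥0} (hs : 0 < s) (t : ℝ≥0)
    {r : ℝ} (hr0 : 0 < r) (hr1 : r < s / (1 + s)) (n : ℕ) :
    ∫ m, meixnerGen β s r m ∂(discLagKernel P s t n) = meixnerGen β s (lagV t * r) n := by
  have hz := meixner_base_mem_Ioo hs hr0 hr1
  have hs : (0 : ℝ) < s := hs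
  rw [lt_div_iff₀ (by positivity)] at hr1
  have hv : (lagV t : ℝ) ≤ 1 := lagV_le_one t
  have h1 : 0 < 1 - r := by nlinarith
  have hvr : 0 < 1 - lagV t * r := by nlinarith [(lagV t).coe_nonneg]
  simp only [meixnerGen, integral_const_mul]
  rw [integral_pow_discLagKernel hP s t n hz, sub_sub_cancel, mul_comm (lagV t : ℝ) (r / _),
    mul_div_one_add_of_eq hs.ne' h1.ne' (lagV_mul_lagU_add s t),
    one_add_mul_mul_of_eq hs.ne' h1.ne' (lagV_mul_lagU_add s t), ← mul_assoc,
    ← Real.mul_rpow h1.le (by positivity), mul_div_cancel₀ _ h1.ne']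

lemma integral_laguerreGen_mul {ς : ℝ≥0} (hς : 0 < ς) {r q : ℝ} (hr0 : 0 ≤ r) (hr1 : r < 1)
    (hq0 : 0 ≤ q) (hq1 : q < 1) :
    ∫ x, laguerreGen β ς r x * laguerreGen β ς q x ∂(gammaInv β ς)
      = (1 - r * q) ^ (-(β : ℝ)) := by
  have hς : (0 : ℝ) < ς := hς
  have h1 : 0 < 1 - r := by linarith
  have h2 : 0 < 1 - q := by linarith
  have e : ∀ x : ℝ≥0, laguerreGen β ς r x * laguerreGen β ς q x
      = ((1 - r) * (1 - q)) ^ (-(β : ℝ)) *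
        Real.exp (-((r / (ς * (1 - r)) + q / (ς * (1 - q))) * x)) := by
    intro x
    have : Real.exp (-((r / (ς * (1 - r)) + q / (ς * (1 - q))) * x))
        = Real.exp (-(r / (ς * (1 - r)) * x)) * Real.exp (-(q / (ς * (1 - q)) * x)) := by
      rw [← Real.exp_add]
      congr 1
      ring
    rw [this, Real.mul_rpow h1.le h2.le, laguerreGen, laguerreGen]
    ring
  simp only [e, integral_const_mul]
  rw [integral_exp_gammaInv β ς (by positivity), ← Real.mul_rpow (by positivity) (by positivity)]
  congr 1
  field_simp
  ring

lemma integral_meixnerGen_mul {s : ℝ≥0} (hs : 0 < s) {r q : ℝ} (hr0 : 0 < r)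
    (hr1 : r < s / (1 + s)) (hq0 : 0 < q) (hq1 : q < s / (1 + s)) :
    ∫ n, meixnerGen β s r n * meixnerGen β s q n ∂(negBinInv β s)
      = (1 - r * q * ((1 + s) / s)) ^ (-(β : ℝ)) := by
  have hzr := meixner_base_mem_Ioo hs hr0 hr1
  have hzq := meixner_base_mem_Ioo hs hq0 hq1
  have hs : (0 : ℝ) < s := hs
  rw [lt_div_iff₀ (by positivity)] at hr1 hq1
  have h1 : 0 < 1 - r := by nlinarith
  have h2 : 0 < 1 - q := by nlinarith
  set a := 1 - r / (s * (1 - r)) with ha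
  set b := 1 - q / (s * (1 - q)) with hb
  have e : ∀ n : ℕ, meixnerGen β s r n * meixnerGen β s q n
      = ((1 - r) * (1 - q)) ^ (-(β : ℝ)) * (a * b) ^ n := by
    intro n
    rw [Real.mul_rpow h1.le h2.le, meixnerGen, meixnerGen, mul_pow]
    ring
  have hab1 : a * b < 1 := mul_lt_one_of_nonneg_of_lt_one_left hzr.1.le hzr.2 hzq.2.le
  have hab0 : 0 < a * b := mul_pos hzr.1 hzq.1
  simp only [e, integral_const_mul]
  rw [integral_pow_negBinInv β s (by rw [abs_of_pos hab0]; nlinarith),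
    ← Real.mul_rpow (by positivity) (by nlinarith)]
  congr 1
  rw [ha, hb]
  field_simp
  ring

/-- The functions `laguerreGen r`, `0 < r < ρ`, are total. -/
lemma ae_eq_zero_of_integral_mul_laguerreGen {ς : ℝ≥0} (hς : 0 < ς) {ρ : ℝ} (hρ0 : 0 < ρ)
    (hρ1 : ρ < 1) {μ : Measure ℝ≥0} {f : ℝ≥0 → ℝ} (hf : Integrable f μ)
    (h : ∀ r ∈ Set.Ioo 0 ρ, ∫ x, f x * laguerreGen β ς r x ∂μ = 0) : f =ᵐ[μ] 0 := by
  have hς : (0 : ℝ) < ς := hς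
  have hρ : 0 < 1 - ρ := by linarith
  refine ae_eq_zero_of_laplace (X := fun x : ℝ≥0 => (x : ℝ)) hf
    NNReal.isClosedEmbedding_coe.measurableEmbedding (fun x => x.2) le_rfl
    (b := ρ / (ς * (1 - ρ))) (by positivity) fun l hl => ?_
  obtain ⟨hl0, hl1⟩ := hl
  rw [lt_div_iff₀ (by positivity)] at hl1
  -- this value of `r` solves `r / (ς (1 - r)) = l`
  have hr := h (ς * l / (1 + ς * l))
    ⟨by positivity, by rw [div_lt_iff₀ (by positivity)]; nlinarith⟩
  have e1 : 1 - ς * l / (1 + ς * l) = 1 / (1 + ς * l) := by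
    field_simp
    ring
  have e2 : ς * l / (1 + ς * l) / (ς * (1 - ς * l / (1 + ς * l))) = l := by
    rw [e1]
    field_simp
  simp only [laguerreGen, e2, mul_left_comm (f _)] at hr
  rw [integral_const_mul] at hr
  refine (mul_eq_zero.1 hr).resolve_left ?_
  rw [e1]
  positivity

/-- The functions `meixnerGen r`, `0 < r < s / (1 + s)`, are total. -/
lemma ae_eq_zero_of_integral_mul_meixnerGen {s : ℝ≥0} (hs : 0 < s)
    {μ : Measure ℕ} {f : ℕ → ℝ} (hf : Integrable f μ)
    (h : ∀ r ∈ Set.Ioo (0 : ℝ) (s / (1 + s)), ∫ n, f n * meixnerGen β s r n ∂μ = 0) :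
    f =ᵐ[μ] 0 := by
  have hs : (0 : ℝ) < s := hs
  refine ae_eq_zero_of_integral_mul_pow hf fun z hz => ?_
  obtain ⟨hz0, hz1⟩ := hz
  have hw : 0 < 1 - z := by linarith
  -- this value of `r` solves `1 - r / (s (1 - r)) = z`
  have hr := h (s * (1 - z) / (1 + s * (1 - z))) ⟨by positivity, by
    rw [div_lt_div_iff₀ (by positivity) (by positivity)]
    nlinarith [mul_pos hs hz0]⟩
  have e1 : 1 - s * (1 - z) / (1 + s * (1 - z)) = 1 / (1 + s * (1 - z)) := by
    field_simp
    ring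
  have e2 : 1 - s * (1 - z) / (1 + s * (1 - z)) / (s * (1 - s * (1 - z) / (1 + s * (1 - z)))) = z := by
    rw [e1]
    field_simp
    ring
  simp only [meixnerGen, e2, mul_left_comm (f _)] at hr
  rw [integral_const_mul] at hr
  refine (mul_eq_zero.1 hr).resolve_left ?_
  rw [e1]
  positivity

lemma memLp_laguerreGen {ς : ℝ≥0} {r : ℝ} (hr0 : 0 ≤ r) (hr1 : r < 1) {μ : Measure ℝ≥0}
    [IsFiniteMeasure μ] : MemLp (laguerreGen β ς r) 2 μ := by
  have h1 : 0 < 1 - r := by linarith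
  refine MemLp.of_bound (by unfold laguerreGen; fun_prop) ((1 - r) ^ (-(β : ℝ)))
    (ae_of_all _ fun x => ?_)
  rw [laguerreGen, norm_mul, Real.norm_of_nonneg (by positivity),
    Real.norm_of_nonneg (by positivity)]
  refine mul_le_of_le_one_right (by positivity) ?_
  rw [Real.exp_le_one_iff, neg_nonpos]
  positivity

lemma memLp_meixnerGen {s : ℝ≥0} (hs : 0 < s) {r : ℝ} (hr0 : 0 < r) (hr1 : r < s / (1 + s))
    {μ : Measure ℕ} [IsFiniteMeasure μ] : MemLp (meixnerGen β s r) 2 μ := by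
  have hz := meixner_base_mem_Ioo hs hr0 hr1
  have hs : (0 : ℝ) < s := hs
  rw [lt_div_iff₀ (by positivity)] at hr1
  have h1 : 0 < 1 - r := by nlinarith
  refine MemLp.of_bound .of_discrete ((1 - r) ^ (-(β : ℝ))) (ae_of_all _ fun n => ?_)
  rw [meixnerGen, norm_mul, Real.norm_of_nonneg (by positivity),
    Real.norm_of_nonneg (pow_nonneg hz.1.le n)]
  exact mul_le_of_le_one_right (by positivity) (pow_le_one₀ hz.1.le hz.2.le)

lemma gammaInv_eq_dirac {β ς : ℝ≥0} (h : β = 0 ∨ ς = 0) : gammaInv β ς = Measure.dirac 0 := by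
  rw [gammaInv, if_neg]
  rintro ⟨h1, h2⟩
  rcases h with rfl | rfl
  · exact h1.ne rfl
  · exact h2.ne rfl

lemma negBinInv_eq_dirac {β s : ℝ≥0} (h : β = 0 ∨ s = 0) : negBinInv β s = Measure.dirac 0 := by
  refine measure_ext_of_integral_pow fun z hz => ?_
  rw [integral_pow_negBinInv β s, integral_dirac, pow_zero]
  · rcases h with rfl | rfl <;> simp
  · rw [abs_of_pos hz.1]
    nlinarith [s.coe_nonneg, hz.2]

/-- The unitary equivalence of the Laguerre semigroups. The two generating functions have Gram
matrices `(1 - r q) ^ (-β)` and `(1 - r q (1 + s) / s) ^ (-β)`, and both semigroups act on them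
by `r ↦ e ^ (-t) r`; hence the unitary operator sends `laguerreGen r` to `meixnerGen (ρ r)` with
`ρ ^ 2 = s / (1 + s)`. If `β ς = 0`, both spaces consist of the constants. -/
lemma exists_unitary_laguerre (hQ : IsSquaredBesselSemigroup β Q)
    (hP : IsLinearBirthDeathSemigroup β P) {ς σ : ℝ≥0} (h : 0 < σ ∨ β = 0 ∨ ς = 0)
    [∀ t, IsMarkovKernel (lagKernel Q ς t)] [∀ t, IsMarkovKernel (discLagKernel P (ς * σ) t)] :
    ∃ U : Lp ℝ 2 (gammaInv β ς) ≃ₗᵢ[ℝ] Lp ℝ 2 (negBinInv β (ς * σ)),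
      ∀ t f, U (markovLp (lagKernel Q ς t) (lagKernel_comp_gammaInv hQ ς t) f)
        = markovLp (discLagKernel P (ς * σ) t) (discLagKernel_comp_negBinInv hQ hP ς σ t)
          (U f) := by
  by_cases h0 : β = 0 ∨ ς = 0
  · have h0' : β = 0 ∨ ς * σ = 0 := h0.imp_right fun h => by rw [h, zero_mul]
    have e₁ := gammaInv_eq_dirac h0
    have e₂ := negBinInv_eq_dirac h0'
    refine exists_unitary_markovLp (ι := Unit) _ _ (ψ := fun _ _ => 1) (φ := fun _ _ => 1)
      (fun _ => memLp_const _) (fun _ => memLp_const _) (by simp) ?_ ?_ (fun _ _ => ())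
      (by simp) (by simp)
    · intro f _ hf
      have := hf ()
      simp only [e₁, mul_one, integral_dirac] at this
      rw [e₁, EventuallyEq, ae_dirac_eq]
      exact this
    · intro f _ hf
      have := hf ()
      simp only [e₂, mul_one, integral_dirac] at this
      rw [e₂, EventuallyEq, ae_dirac_eq]
      exact this
  · have hς : 0 < ς := pos_iff_ne_zero.2 fun h => h0 (Or.inr h)
    have hσ : 0 < σ := h.resolve_right h0
    have hs : 0 < ς * σ := mul_pos hς hσ
    set s := ς * σ with hsdef
    have hs' : (0 : ℝ) < s := hs
    set ρ : ℝ := Real.sqrt (s / (1 + s)) with hρdef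
    have hρ2 : ρ * ρ = s / (1 + s) := Real.mul_self_sqrt (by positivity)
    have hρ0 : 0 < ρ := Real.sqrt_pos.2 (by positivity)
    have hρ1 : ρ < 1 := by
      rw [hρdef, Real.sqrt_lt' one_pos, div_lt_iff₀ (by positivity)]
      linarith
    have hlt : ∀ r : Set.Ioo 0 ρ, (r : ℝ) < 1 := fun r => r.2.2.trans hρ1
    have hpos : ∀ r : Set.Ioo 0 ρ, 0 < ρ * r := fun r => mul_pos hρ0 r.2.1
    have hlt' : ∀ r : Set.Ioo 0 ρ, ρ * r < s / (1 + s) := fun r => by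
      rw [← hρ2]
      exact mul_lt_mul_of_pos_left r.2.2 hρ0
    refine exists_unitary_markovLp (ι := Set.Ioo 0 ρ) _ _ (ψ := fun r => laguerreGen β ς r)
      (φ := fun r => meixnerGen β s (ρ * r)) (fun r => memLp_laguerreGen r.2.1.le (hlt r))
      (fun r => memLp_meixnerGen hs (hpos r) (hlt' r)) ?_ ?_ ?_
      (fun t r => ⟨lagV t * r, mul_pos (lagV_pos t) r.2.1,
        (mul_le_of_le_one_left r.2.1.le (lagV_le_one t)).trans_lt r.2.2⟩)
      (fun t r x => integral_laguerreGen hQ hς t r.2.1.le (hlt r) x) ?_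
    · intro r q
      rw [integral_laguerreGen_mul hς r.2.1.le (hlt r) q.2.1.le (hlt q),
        integral_meixnerGen_mul hs (hpos r) (hlt' r) (hpos q) (hlt' q)]
      congr 2
      have : ρ * r * (ρ * q) * ((1 + s) / s) = r * q * (ρ * ρ * ((1 + s) / s)) := by ring
      rw [this, hρ2]
      field_simp
    · exact fun f hf hr => ae_eq_zero_of_integral_mul_laguerreGen hς hρ0 hρ1 hf
        fun r hr' => hr ⟨r, hr'⟩
    · refine fun f hf hr => ae_eq_zero_of_integral_mul_meixnerGen (β := β) hs hf fun r hr' => ?_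
      have := hr ⟨r / ρ, div_pos hr'.1 hρ0, by
        rw [div_lt_iff₀ hρ0, hρ2]
        exact hr'.2⟩
      simpa only [mul_div_cancel₀ r hρ0.ne'] using this
    · intro t r n
      rw [integral_meixnerGen hP hs t (hpos r) (hlt' r), mul_left_comm]

end LaguerreUnitary

/-! ### The intertwining relations and the unitary equivalence -/

theorem proposition22 (β : ℝ≥0)
    (Q : ℝ≥0 → Kernel ℝ≥0 ℝ≥0) (hQ : IsSquaredBesselSemigroup β Q)
    (P : ℝ≥0 → Kernel ℕ ℕ) (hP : IsLinearBirthDeathSemigroup β P) :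
    -- the two-parameter operators, on `c₀(ℤ₊)`
    (∀ σ u v : ℝ≥0, 0 < v →
      -- `S_{(u,v)} Λ_σ f = Λ_σ 𝕊_{(σu,v)} f` wherever the right-hand side converges absolutely
      (∀ (f : C₀(ℕ, ℝ)) (x : ℝ≥0),
        Integrable (discDil v f) ((poissonMeasure (σ * x)).bind (P (σ * u))) →
          contS Q u v (poissonDil σ f) x = poissonDil σ (discS P (σ * u) v f) x) ∧
      -- which is everywhere, for all `f`, if `2σu(v-1) < 1`, in particular if `v ≤ 1`
      (2 * ((σ : ℝ) * (u : ℝ)) * ((v : ℝ) - 1) < 1 → ∀ f : C₀(ℕ, ℝ),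
        (∀ x : ℝ≥0, Integrable (discDil v f) ((poissonMeasure (σ * x)).bind (P (σ * u)))) ∧
        (∀ n : ℕ, Integrable (discDil v f) (P (σ * u) n)) ∧
        discS P (σ * u) v f = discDil v (kernelAct (P (v * (σ * u))) f)) ∧
      -- for all `(u,v)`, with `𝕊_{(σu,v)}` in the form `𝔻_v P_{vσu}`
      (∀ (f : C₀(ℕ, ℝ)) (x : ℝ≥0),
        Integrable (discDil v (kernelAct (P (v * (σ * u))) f)) (poissonMeasure (σ * x)) ∧
        contS Q u v (poissonDil σ f) x =
          poissonDil σ (discDil v (kernelAct (P (v * (σ * u))) f)) x)) ∧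
    -- the Laguerre semigroups, on `c₀(ℤ₊)`
    (∀ (ς σ t : ℝ≥0) (f : C₀(ℕ, ℝ)) (x : ℝ≥0),
      contK Q ς t (poissonDil σ f) x = poissonDil σ (discK P (ς * σ) t f) x) ∧
    -- the Laguerre semigroups, on `ℓ²(𝔫_{ςσ})`, and the unitary equivalence
    (∀ ς σ : ℝ≥0,
      ∃ (L : Lp ℝ 2 (negBinInv β (ς * σ)) →L[ℝ] Lp ℝ 2 (gammaInv β ς))
        (A : ℝ≥0 → Lp ℝ 2 (gammaInv β ς) →L[ℝ] Lp ℝ 2 (gammaInv β ς))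
        (B : ℝ≥0 → Lp ℝ 2 (negBinInv β (ς * σ)) →L[ℝ] Lp ℝ 2 (negBinInv β (ς * σ))),
        -- `L`, `A t`, `B t` are the operators `Λ_σ`, `K_t`, `𝕂_t` on the `L²` spaces
        (∀ g : Lp ℝ 2 (negBinInv β (ς * σ)), (∀ᵐ x ∂(gammaInv β ς), Integrable g (poissonMeasure (σ * x))) ∧
          L g =ᵐ[gammaInv β ς] poissonDil σ g) ∧
        (∀ (t : ℝ≥0) (f : Lp ℝ 2 (gammaInv β ς)),
          (∀ᵐ x ∂(gammaInv β ς), Integrable (dil (lagV t) f) (Q (lagU ς t) x)) ∧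
          A t f =ᵐ[gammaInv β ς] contK Q ς t f) ∧
        (∀ (t : ℝ≥0) (g : Lp ℝ 2 (negBinInv β (ς * σ))), (∀ᵐ n ∂(negBinInv β (ς * σ)),
            Integrable (discDil (lagV t) g) (P (lagU (ς * σ) t) n)) ∧
          B t g =ᵐ[negBinInv β (ς * σ)] discK P (ς * σ) t g) ∧
        (∀ t g, A t (L g) = L (B t g)) ∧
        ((0 < σ ∨ β = 0 ∨ ς = 0) →
          ∃ U : Lp ℝ 2 (gammaInv β ς) ≃ₗᵢ[ℝ] Lp ℝ 2 (negBinInv β (ς * σ)),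
            ∀ t f, U (A t f) = B t (U f))) := by
  refine ⟨fun σ u v _ => ⟨fun f x hI =>
    contS_poissonDil_eq_of_integrable hQ hP σ u v f.norm_apply_le x hI, fun h f => ?_,
    fun f x => contS_poissonDil_eq hQ hP σ u v f.norm_apply_le x⟩, fun ς σ t f x => ?_,
    fun ς σ => ?_⟩
  · have h' : 2 * ((σ * u : ℝ≥0) : ℝ) * ((v : ℝ) - 1) < 1 := by rwa [NNReal.coe_mul]
    exact ⟨fun x => integrable_discDil_poisson_bind hP h' f.norm_apply_le _,
      fun n => integrable_discDil_birthDeath hP h' f.norm_apply_le n,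
      discS_eq_discDil_kernelAct hP h' f.norm_apply_le⟩
  · rw [contK, discK, lagU_mul]
    refine contS_poissonDil_eq_of_integrable hQ hP σ _ _ f.norm_apply_le x
      (integrable_discDil_poisson_bind hP ?_ f.norm_apply_le _)
    -- `v = e ^ (-t) ≤ 1`, so the condition on `(u, v)` holds
    have h1 : (lagV t : ℝ) ≤ 1 := lagV_le_one t
    have h2 := (σ * lagU ς t).coe_nonneg
    nlinarith
  · have hA : ∀ t, IsMarkovKernel (lagKernel Q ς t) := isMarkovKernel_lagKernel hQ ς
    have hB : ∀ t, IsMarkovKernel (discLagKernel P (ς * σ) t) :=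
      isMarkovKernel_discLagKernel hP (ς * σ)
    have hL := poissonDilKernel_comp_gammaInv β ς σ
    have hAi := lagKernel_comp_gammaInv hQ ς
    have hBi := discLagKernel_comp_negBinInv hQ hP ς σ
    refine ⟨markovLp (poissonDilKernel σ) hL, fun t => markovLp (lagKernel Q ς t) (hAi t),
      fun t => markovLp (discLagKernel P (ς * σ) t) (hBi t),
      fun g => ⟨ae_integrable_Lp_two hL g, coeFn_markovLp hL g⟩, fun t f => ⟨?_, ?_⟩,
      fun t g => ⟨?_, ?_⟩, fun t g => ?_, fun h => exists_unitary_laguerre hQ hP h⟩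
    · filter_upwards [ae_integrable_Lp_two (hAi t) f] with x hx
      exact (integrable_lagKernel_iff ς t (Lp.stronglyMeasurable f) x).1 hx
    · filter_upwards [coeFn_markovLp (hAi t) f] with x hx
      rw [hx]
      exact integral_lagKernel ς t (Lp.stronglyMeasurable f) x
    · filter_upwards [ae_integrable_Lp_two (hBi t) g] with n hn
      exact (integral_discLagKernel (ς * σ) t hn).1
    · filter_upwards [ae_integrable_Lp_two (hBi t) g, coeFn_markovLp (hBi t) g] with n hn hn'
      rw [hn']
      exact (integral_discLagKernel (ς * σ) t hn).2
    · have e := discLagKernel_comp_poissonDilKernel hQ hP ς σ t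
      have hc : (discLagKernel P (ς * σ) t ∘ₖ poissonDilKernel σ) ∘ₘ gammaInv β ς
          = negBinInv β (ς * σ) := by rw [← Measure.comp_assoc, hL, hBi]
      have hc' : (poissonDilKernel σ ∘ₖ lagKernel Q ς t) ∘ₘ gammaInv β ς
          = negBinInv β (ς * σ) := by rw [← e, hc]
      rw [markovLp_markovLp (hAi t) hL hc', markovLp_markovLp hL (hBi t) hc, markovLp_congr e]
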